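/- **Setting.** Consider a Kac-Moody root system with index set $I$: a generalized Cartan matrix $(a_{ij})_{i,j\in I}$, linearly independent simple roots $\alpha_i$ $(i\in I)$ in a real vector space $V$, and simple coroots $\alpha_i^\vee\in V^*$ with $\langle\alpha_i^\vee,\alpha_j\rangle=a_{ij}$. Let $s_i(x)=x-\langle\alpha_i^\vee,x\rangle\alpha_i$, let $W\subset GL(V)$ be the Weyl group generated by $S=\{s_i\}_{i\in I}$, let $\ell:W\to\mathbb{N}$ be the length function, and write $\alpha_{s_i}=\alpha_i$. Let $\Delta=\bigcup_{i\in I} W\alpha_i$ be the set of (real) roots and $\Delta_+$ the set of roots that are sums of simple roots. An *orientation* $A$ is a decomposition $\Delta=\Delta^A_+\sqcup\Delta^A_-$ with $\Delta^A_-=-\Delta^A_+$ such that $\alpha,\beta\in\Delta^A_+$, $a,b>0$ and $a\alpha+b\beta\in\Delta$ imply $a\alpha+b\beta\in\Delta^A_+$. For $\beta\in\Delta$ put $\mathrm{sgn}_A(\beta)=\pm1$ if $\beta\in\Delta^A_\pm$. Let $A_0$ be given by $\Delta^{A_0}_+=\Delta_+$ and $-A_0$ by $\Delta^{-A_0}_+=-\Delta_+$;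 these are orientations. An expression is a tuple $\sigma=(\sigma_1,\dots,\sigma_r)\in S^r$ $(r\ge 0)$; it is a reduced expression for $w$ if $\sigma_1\cdots\sigma_r=w$ and $\ell(w)=r$. A subexpression of $\sigma$ is a tuple $\tau=(\tau_1,\dots,\tau_r)$ with $\tau_k\in\{e,\sigma_k\}$; put $\pi(\tau)=\tau_1\cdots\tau_r$ and $\kappa_\tau=\#\{k\mid\tau_k=e\}$. The subexpression $\tau$ of $\sigma$ is *distinguished with respect to $(A_0,-A_0)$* if for every $k$ with $\tau_k=e$ $$\mathrm{sgn}_{A_0}(-\sigma_1\cdots\sigma_k(\alpha_{\sigma_k}))=\mathrm{sgn}_{-A_0}(-\tau_1\cdots\tau_k(\alpha_{\sigma_k})).$$ Let $\mathcal{H}$ be the Hecke algebra of $W$: the unital $\mathbb{Z}[v,v^{-1}]$-algebra generated by $T_i$ $(i\in I)$ with the braid relations and $(T_i-v)(T_i+v^{-1})=0$. Put $T_w=T_{i_1}\cdots T_{i_r}$ for a reduced expression $(s_{i_1},\dots,s_{i_r})$ of $w$, and let $\overline{\,\cdot\,}$ be the ring involution of $\mathcal{H}$ with $\overline{v}=v^{-1}$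 and $\overline{T_i}=T_i^{-1}$. **Theorem (Deodhar's formula).** There is a unique family $R_{u,w}\in\mathbb{Z}[v,v^{-1}]$ $(u,w\in W)$, with $R_{u,w}\neq0$ for only finitely many $u$ for each $w$, such that $$T_w=\sum_{u\in W}v^{\ell(u)-\ell(w)}\,R_{u,w}\,\overline{T_u}\qquad\text{for all }w\in W$$ (the $R$-polynomials). For all $u,w\in W$ and every reduced expression $\sigma$ for $w$, $$R_{u,w}=\sum_{\tau}v^{\ell(w)-\ell(u)}(v-v^{-1})^{\kappa_\tau},$$ where $\tau$ runs over the subexpressions of $\sigma$ with $\pi(\tau)=u$ that are distinguished with respect to $(A_0,-A_0)$. -/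

import Mathlib

open scoped LaurentPolynomial

noncomputable section

/-- A Kac-Moody root system with index set `I`, realized in a real vector space `V`: a generalized
Cartan matrix `A`, linearly independent simple roots `α_i ∈ V`, and simple coroots `α_i^∨ ∈ V^*`
with `⟨α_i^∨, α_j⟩ = a_{ij}`. The space `V` is not required to be of a particular dimension (so it
can be the real form of the dual of a Cartan subalgebra, or just the real span of the roots). -/
structure KacMoodyRootSystem (I V : Type*) [AddCommGroup V] [Module ℝ V] where
  /-- the generalized Cartan matrix -/
  cartan : Matrix I I ℤ
  cartan_diag : ∀ i, cartan i i = 2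
  cartan_offDiag : ∀ i j, i ≠ j → cartan i j ≤ 0
  cartan_zero : ∀ i j, cartan i j = 0 → cartan j i = 0
  /-- the simple roots -/
  root : I → V
  /-- the simple coroots -/
  coroot : I → Module.Dual ℝ V
  linearIndependent_root : LinearIndependent ℝ root
  coroot_root : ∀ i j, coroot i (root j) = (cartan i j : ℝ)

namespace KacMoodyRootSystem

variable {I V : Type*} [AddCommGroup V] [Module ℝ V] (Φ : KacMoodyRootSystem I V)

theorem coroot_root_self (i : I) : Φ.coroot i (Φ.root i) = 2 := by
  rw [Φ.coroot_root, Φ.cartan_diag]; norm_num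

/-- The simple reflection `s_i (x) = x - ⟨α_i^∨, x⟩ α_i` as an automorphism of `V`. -/
def reflection (i : I) : V ≃ₗ[ℝ] V := Module.reflection (Φ.coroot_root_self i)

/-- The Weyl group: the group of automorphisms of `V` generated by the simple reflections. -/
abbrev Weyl : Subgroup (V ≃ₗ[ℝ] V) := Subgroup.closure (Set.range Φ.reflection)

/-- The simple reflections as elements of the Weyl group. -/
def s (i : I) : Φ.Weyl := ⟨Φ.reflection i, Subgroup.subset_closure ⟨i, rfl⟩⟩

/-- The set `Δ` of (real) roots: the Weyl group orbits of the simple roots. -/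
def roots : Set V := {β | ∃ (w : Φ.Weyl) (i : I), β = (w : V ≃ₗ[ℝ] V) (Φ.root i)}

/-- The set `Δ_+` of positive roots: the roots that are sums of simple roots. -/
def posRoots : Set V := {β | β ∈ Φ.roots ∧ β ∈ AddSubmonoid.closure (Set.range Φ.root)}

/-! ### Expressions, subexpressions, length -/

/-- The product `π(σ)` of an expression `σ = (s_{i_1}, …, s_{i_r})`, which is recorded by the tuple
`(i_1, …, i_r)`. -/
def prod {r : ℕ} (σ : Fin r → I) : Φ.Weyl := (List.ofFn fun k => Φ.s (σ k)).prod

/-- The entries `τ_k ∈ {e, σ_k}` of a subexpression `τ` of `σ`. As `σ_k ≠ e`, a subexpression is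
recorded by the set of the indices `k` with `τ_k = σ_k`. -/
def entry {r : ℕ} (σ : Fin r → I) (τ : Finset (Fin r)) (k : Fin r) : Φ.Weyl :=
  if k ∈ τ then Φ.s (σ k) else 1

/-- The product `π(τ) = τ_1 ⋯ τ_r` of a subexpression. -/
def subProd {r : ℕ} (σ : Fin r → I) (τ : Finset (Fin r)) : Φ.Weyl :=
  (List.ofFn (Φ.entry σ τ)).prod

/-- The vector `-τ_1 ⋯ τ_k (α_{σ_k})`. -/
def wallRoot {r : ℕ} (σ : Fin r → I) (τ : Finset (Fin r)) (k : Fin r) : V :=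
  -((Fin.partialProd (Φ.entry σ τ) k.succ : Φ.Weyl) : V ≃ₗ[ℝ] V) (Φ.root (σ k))

/-- The statistic `κ_τ = #{k | τ_k = e}`. -/
def kappa {r : ℕ} (τ : Finset (Fin r)) : ℕ := (τᶜ).card

/-- The length function `ℓ : W → ℕ`. -/
def length (w : Φ.Weyl) : ℕ := sInf {r | ∃ σ : Fin r → I, Φ.prod σ = w}

/-- `σ` is a reduced expression (for the Weyl group element `π(σ)`). -/
def IsReduced {r : ℕ} (σ : Fin r → I) : Prop := Φ.length (Φ.prod σ) = r

theorem exists_expression (w : Φ.Weyl) : ∃ (r : ℕ) (σ : Fin r → I), Φ.prod σ = w := by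
  have key : ∀ g ∈ Φ.Weyl, ∃ l : List I, (l.map Φ.reflection).prod = g := by
    intro g hg
    induction hg using Subgroup.closure_induction with
    | mem x hx => obtain ⟨i, rfl⟩ := hx; exact ⟨[i], by simp⟩
    | one => exact ⟨[], rfl⟩
    | mul x y _ _ hx hy =>
      obtain ⟨l, rfl⟩ := hx
      obtain ⟨m, rfl⟩ := hy
      exact ⟨l ++ m, by simp⟩
    | inv x _ hx =>
      obtain ⟨l, rfl⟩ := hx
      refine ⟨l.reverse, ?_⟩
      have hinv : ∀ i, (Φ.reflection i)⁻¹ = Φ.reflection i := fun i =>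
        inv_eq_of_mul_eq_one_left (by
          ext x; simpa [reflection] using Module.involutive_reflection (Φ.coroot_root_self i) x)
      rw [List.prod_inv_reverse, List.map_reverse, List.map_map]
      rw [show (fun x => x⁻¹) ∘ Φ.reflection = Φ.reflection from funext hinv]
  obtain ⟨l, hl⟩ := key w w.2
  refine ⟨l.length, l.get, Subtype.ext ?_⟩
  rw [← hl, prod, SubmonoidClass.coe_list_prod, List.map_ofFn]
  congr 1
  conv_rhs => rw [← List.ofFn_get l, List.map_ofFn]
  rfl

theorem exists_reduced (w : Φ.Weyl) : ∃ σ : Fin (Φ.length w) → I, Φ.prod σ = w :=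
  Nat.sInf_mem (s := {r | ∃ σ : Fin r → I, Φ.prod σ = w}) (Φ.exists_expression w)

/-! ### Orientations and distinguished subexpressions -/

/-- `P` is the positive part `Δ^A_+` of an orientation `A` of the set of roots (the negative part
is `Δ^A_- = -Δ^A_+`). -/
structure IsOrientation (P : Set V) : Prop where
  union : P ∪ -P = Φ.roots
  disjoint : Disjoint P (-P)
  convex : ∀ α ∈ P, ∀ β ∈ P, ∀ a b : ℝ, 0 < a → 0 < b →
    a • α + b • β ∈ Φ.roots → a • α + b • β ∈ P

open Classical in
/-- The sign `sgn_A(β)` of a root `β` for the orientation `A` with `Δ^A_+ = P`. -/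
def sgn (P : Set V) (β : V) : ℤ := if β ∈ P then 1 else -1

/-- `ρ` is a distinguished subexpression of the subexpression `τ` of `σ`, with respect to the
orientations `A` and `A'` with positive parts `P` and `P'`. -/
def IsDistinguished (P P' : Set V) {r : ℕ} (σ : Fin r → I) (τ ρ : Finset (Fin r)) : Prop :=
  ρ ⊆ τ ∧ ∀ k, k ∉ ρ → k ∈ τ → sgn P (Φ.wallRoot σ τ k) = sgn P' (Φ.wallRoot σ ρ k)

/-! ### The Hecke algebra and the Kazhdan-Lusztig involution -/

/-- The alternating product `a b a ⋯` with `n` factors. -/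
def altProd {M : Type*} [Monoid M] (a b : M) : ℕ → M
  | 0 => 1
  | n + 1 => a * altProd b a n

/-- The relations of the Hecke algebra: the braid relations `T_i T_j T_i ⋯ = T_j T_i T_j ⋯` with
`m_{ij}` factors on both sides, `m_{ij}` being the order of `s_i s_j` in the Weyl group (no
condition if this order is infinite, as then `orderOf` is `0`; none if `i = j`), and the quadratic
relations `(T_i - v)(T_i + v⁻¹) = 0`. Here `v` and `v⁻¹` are `LaurentPolynomial.T 1` and
`LaurentPolynomial.T (-1)`. -/
inductive HeckeRel : FreeAlgebra ℤ[T;T⁻¹] I → FreeAlgebra ℤ[T;T⁻¹] I → Prop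
  | braid (i j : I) : HeckeRel
      (altProd (FreeAlgebra.ι ℤ[T;T⁻¹] i) (FreeAlgebra.ι ℤ[T;T⁻¹] j) (orderOf (Φ.s i * Φ.s j)))
      (altProd (FreeAlgebra.ι ℤ[T;T⁻¹] j) (FreeAlgebra.ι ℤ[T;T⁻¹] i) (orderOf (Φ.s i * Φ.s j)))
  | quadratic (i : I) : HeckeRel
      ((FreeAlgebra.ι ℤ[T;T⁻¹] i - algebraMap ℤ[T;T⁻¹] _ (LaurentPolynomial.T 1)) *
        (FreeAlgebra.ι ℤ[T;T⁻¹] i + algebraMap ℤ[T;T⁻¹] _ (LaurentPolynomial.T (-1)))) 0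

/-- The Hecke algebra of the Weyl group, over `ℤ[v, v⁻¹]`. -/
def Hecke := RingQuot Φ.HeckeRel

instance : Ring Φ.Hecke := inferInstanceAs (Ring (RingQuot Φ.HeckeRel))

instance : Algebra ℤ[T;T⁻¹] Φ.Hecke := inferInstanceAs (Algebra ℤ[T;T⁻¹] (RingQuot Φ.HeckeRel))

/-- The quotient map from the free algebra to the Hecke algebra. -/
def heckeMk : FreeAlgebra ℤ[T;T⁻¹] I →ₐ[ℤ[T;T⁻¹]] Φ.Hecke :=
  RingQuot.mkAlgHom ℤ[T;T⁻¹] Φ.HeckeRel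

theorem heckeMk_rel {x y : FreeAlgebra ℤ[T;T⁻¹] I} (h : Φ.HeckeRel x y) :
    Φ.heckeMk x = Φ.heckeMk y :=
  RingQuot.mkAlgHom_rel ℤ[T;T⁻¹] h

/-- The universal property of the Hecke algebra. -/
def heckeLift {B : Type*} [Ring B] [Algebra ℤ[T;T⁻¹] B] (f : FreeAlgebra ℤ[T;T⁻¹] I →ₐ[ℤ[T;T⁻¹]] B)
    (hf : ∀ ⦃x y⦄, Φ.HeckeRel x y → f x = f y) : Φ.Hecke →ₐ[ℤ[T;T⁻¹]] B :=
  RingQuot.liftAlgHom ℤ[T;T⁻¹] ⟨f, hf⟩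

theorem heckeLift_heckeMk {B : Type*} [Ring B] [Algebra ℤ[T;T⁻¹] B]
    (f : FreeAlgebra ℤ[T;T⁻¹] I →ₐ[ℤ[T;T⁻¹]] B) (hf : ∀ ⦃x y⦄, Φ.HeckeRel x y → f x = f y)
    (x : FreeAlgebra ℤ[T;T⁻¹] I) : Φ.heckeLift f hf (Φ.heckeMk x) = f x :=
  RingQuot.liftAlgHom_mkAlgHom_apply ℤ[T;T⁻¹] f hf x

/-- The generators `T_i` of the Hecke algebra. -/
def heckeGen (i : I) : Φ.Hecke := Φ.heckeMk (FreeAlgebra.ι ℤ[T;T⁻¹] i)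

/-- `T_w = T_{i_1} ⋯ T_{i_r}` for a reduced expression `(s_{i_1}, …, s_{i_r})` of `w`. -/
def heckeT (w : Φ.Weyl) : Φ.Hecke :=
  (List.ofFn fun k => Φ.heckeGen ((Φ.exists_reduced w).choose k)).prod

theorem map_altProd {M N F : Type*} [Monoid M] [Monoid N] [FunLike F M N] [MonoidHomClass F M N]
    (f : F) (n : ℕ) : ∀ a b : M, f (altProd a b n) = altProd (f a) (f b) n := by
  induction n with
  | zero => intro a b; exact map_one f
  | succ n ih => intro a b; simp only [altProd, map_mul, ih]

theorem altProd_succ' {M : Type*} [Monoid M] (n : ℕ) : ∀ a b : M,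
    altProd a b (n + 1) = altProd a b n * (if Even n then a else b) := by
  induction n with
  | zero => intro a b; simp [altProd]
  | succ n ih =>
    intro a b
    rw [altProd, ih b a, altProd, mul_assoc]
    by_cases h : Even n <;> simp [h, Nat.even_add_one]

theorem altProd_inv {G : Type*} [Group G] (n : ℕ) : ∀ a b : G,
    (altProd a b n)⁻¹ = if Even n then altProd b⁻¹ a⁻¹ n else altProd a⁻¹ b⁻¹ n := by
  induction n with
  | zero => intro a b; simp [altProd]
  | succ n ih =>
    intro a b
    rw [altProd_succ', mul_inv_rev, ih]
    by_cases h : Even n <;> simp [h, Nat.even_add_one, altProd]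

theorem altProd_inv_comm {G : Type*} [Group G] {n : ℕ} {a b : G}
    (h : altProd a b n = altProd b a n) : altProd a⁻¹ b⁻¹ n = altProd b⁻¹ a⁻¹ n := by
  have h' := congrArg (fun x => x⁻¹) h
  simp only [altProd_inv] at h'
  split_ifs at h' with hn
  · exact h'.symm
  · exact h'

theorem heckeGen_braid (i j : I) :
    altProd (Φ.heckeGen i) (Φ.heckeGen j) (orderOf (Φ.s i * Φ.s j)) =
      altProd (Φ.heckeGen j) (Φ.heckeGen i) (orderOf (Φ.s i * Φ.s j)) := by
  have h := Φ.heckeMk_rel (HeckeRel.braid i j)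
  rwa [map_altProd, map_altProd] at h

theorem heckeGen_quadratic (i : I) :
    (Φ.heckeGen i - algebraMap ℤ[T;T⁻¹] _ (LaurentPolynomial.T 1)) *
      (Φ.heckeGen i + algebraMap ℤ[T;T⁻¹] _ (LaurentPolynomial.T (-1))) = 0 := by
  have h := Φ.heckeMk_rel (HeckeRel.quadratic i)
  simpa only [map_mul, map_sub, map_add, map_zero, AlgHom.commutes, heckeGen] using h

theorem algebraMap_T_mul (a b : ℤ) (h : a + b = 0) :
    algebraMap ℤ[T;T⁻¹] Φ.Hecke (LaurentPolynomial.T a) *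
      algebraMap ℤ[T;T⁻¹] Φ.Hecke (LaurentPolynomial.T b) = 1 := by
  rw [← map_mul, ← LaurentPolynomial.T_add, h, LaurentPolynomial.T_zero, map_one]

/-- `T_i` as a unit, with inverse `T_i⁻¹ = T_i - (v - v⁻¹)`. -/
def heckeUnit (i : I) : (Φ.Hecke)ˣ where
  val := Φ.heckeGen i
  inv := Φ.heckeGen i -
    (algebraMap ℤ[T;T⁻¹] _ (LaurentPolynomial.T 1) -
      algebraMap ℤ[T;T⁻¹] _ (LaurentPolynomial.T (-1)))
  val_inv := by
    have h := Φ.heckeGen_quadratic i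
    rw [sub_mul, mul_add, mul_add, Algebra.commutes, Φ.algebraMap_T_mul 1 (-1) (by norm_num)] at h
    rw [mul_sub, mul_sub, ← sub_eq_zero, ← h]
    abel
  inv_val := by
    have h := Φ.heckeGen_quadratic i
    rw [sub_mul, mul_add, mul_add, Φ.algebraMap_T_mul 1 (-1) (by norm_num),
      ← Algebra.commutes (LaurentPolynomial.T (-1) : ℤ[T;T⁻¹])] at h
    rw [sub_mul, sub_mul, ← sub_eq_zero, ← h]
    abel

/-- The Hecke algebra with `ℤ[v, v⁻¹]` acting through the automorphism `v ↦ v⁻¹`; it serves to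
construct the Kazhdan-Lusztig involution. -/
def HeckeTwist := Φ.Hecke

instance : Ring Φ.HeckeTwist := inferInstanceAs (Ring Φ.Hecke)

instance : Algebra ℤ[T;T⁻¹] Φ.HeckeTwist :=
  RingHom.toAlgebra'
    (((algebraMap ℤ[T;T⁻¹] Φ.Hecke).comp
      (LaurentPolynomial.invert : ℤ[T;T⁻¹] ≃ₐ[ℤ] ℤ[T;T⁻¹]).toRingEquiv.toRingHom :
        ℤ[T;T⁻¹] →+* Φ.Hecke))
    (fun c x => Algebra.commutes (A := Φ.Hecke) (LaurentPolynomial.invert c) x)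

theorem algebraMap_twist (c : ℤ[T;T⁻¹]) :
    algebraMap ℤ[T;T⁻¹] Φ.HeckeTwist c =
      algebraMap ℤ[T;T⁻¹] Φ.Hecke (LaurentPolynomial.invert c) := rfl

/-- The homomorphism `T_i ↦ T_i⁻¹` on the free algebra. -/
def barFree : FreeAlgebra ℤ[T;T⁻¹] I →ₐ[ℤ[T;T⁻¹]] Φ.HeckeTwist :=
  FreeAlgebra.lift ℤ[T;T⁻¹] (fun i => (show Φ.HeckeTwist from (↑(Φ.heckeUnit i)⁻¹ : Φ.Hecke)))

theorem barFree_ι (i : I) : Φ.barFree (FreeAlgebra.ι ℤ[T;T⁻¹] i) =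
    (show Φ.HeckeTwist from (↑(Φ.heckeUnit i)⁻¹ : Φ.Hecke)) :=
  FreeAlgebra.lift_ι_apply _ _

theorem barFree_rel {x y : FreeAlgebra ℤ[T;T⁻¹] I} (h : Φ.HeckeRel x y) :
    Φ.barFree x = Φ.barFree y := by
  induction h with
  | braid i j =>
    rw [map_altProd, map_altProd, barFree_ι, barFree_ι]
    have h : altProd (Φ.heckeUnit i) (Φ.heckeUnit j) (orderOf (Φ.s i * Φ.s j)) =
        altProd (Φ.heckeUnit j) (Φ.heckeUnit i) (orderOf (Φ.s i * Φ.s j)) := by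
      apply Units.ext
      have := Φ.heckeGen_braid i j
      rw [← Units.coeHom_apply, ← Units.coeHom_apply, map_altProd, map_altProd]
      exact this
    have h' := congrArg (Units.coeHom Φ.Hecke) (altProd_inv_comm h)
    rw [map_altProd, map_altProd] at h'
    exact h'
  | quadratic i =>
    rw [map_mul, map_sub, map_add, AlgHom.commutes, AlgHom.commutes, map_zero, barFree_ι,
      algebraMap_twist, algebraMap_twist,
      LaurentPolynomial.invert_T, LaurentPolynomial.invert_T, neg_neg]
    have h := Φ.heckeGen_quadratic i
    set a := algebraMap ℤ[T;T⁻¹] Φ.Hecke (LaurentPolynomial.T 1) with ha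
    set b := algebraMap ℤ[T;T⁻¹] Φ.Hecke (LaurentPolynomial.T (-1)) with hb
    have h1 := Algebra.commutes (LaurentPolynomial.T 1 : ℤ[T;T⁻¹]) (Φ.heckeGen i)
    have h2 := Algebra.commutes (LaurentPolynomial.T (-1) : ℤ[T;T⁻¹]) (Φ.heckeGen i)
    rw [← ha] at h1
    rw [← hb] at h2
    have goal : ((Φ.heckeGen i - (a - b)) - b) * ((Φ.heckeGen i - (a - b)) + a) = 0 := by
      rw [show (Φ.heckeGen i - (a - b)) - b = Φ.heckeGen i - a by abel,
        show (Φ.heckeGen i - (a - b)) + a = Φ.heckeGen i + b by abel]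
      exact h
    exact goal

/-- The Kazhdan-Lusztig involution of the Hecke algebra: the ring endomorphism with
`v ↦ v⁻¹` and `T_i ↦ T_i⁻¹`. -/
def bar : Φ.Hecke →+* Φ.Hecke :=
  let f : Φ.Hecke →+* Φ.HeckeTwist := (Φ.heckeLift Φ.barFree fun _ _ h => Φ.barFree_rel h).toRingHom
  f

theorem bar_algebraMap (c : ℤ[T;T⁻¹]) :
    Φ.bar (algebraMap ℤ[T;T⁻¹] Φ.Hecke c) =
      algebraMap ℤ[T;T⁻¹] Φ.Hecke (LaurentPolynomial.invert c) := by
  have h := AlgHom.commutes (Φ.heckeLift Φ.barFree fun _ _ h => Φ.barFree_rel h) c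
  exact h

theorem bar_heckeGen (i : I) : Φ.bar (Φ.heckeGen i) = ↑(Φ.heckeUnit i)⁻¹ :=
  (Φ.heckeLift_heckeMk Φ.barFree (fun _ _ h => Φ.barFree_rel h) (FreeAlgebra.ι ℤ[T;T⁻¹] i)).trans
    (Φ.barFree_ι i)

theorem bar_heckeGen_inv (i : I) : Φ.bar ↑(Φ.heckeUnit i)⁻¹ = Φ.heckeGen i := by
  change Φ.bar (Φ.heckeGen i - (algebraMap ℤ[T;T⁻¹] _ (LaurentPolynomial.T 1) -
    algebraMap ℤ[T;T⁻¹] _ (LaurentPolynomial.T (-1)))) = _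
  rw [map_sub, map_sub, bar_heckeGen, bar_algebraMap, bar_algebraMap, LaurentPolynomial.invert_T,
    LaurentPolynomial.invert_T, neg_neg]
  change Φ.heckeGen i - (algebraMap ℤ[T;T⁻¹] _ (LaurentPolynomial.T 1) -
    algebraMap ℤ[T;T⁻¹] _ (LaurentPolynomial.T (-1))) - _ = _
  abel

theorem bar_bar (x : Φ.Hecke) : Φ.bar (Φ.bar x) = x := by
  obtain ⟨y, rfl⟩ := RingQuot.mkAlgHom_surjective ℤ[T;T⁻¹] Φ.HeckeRel x
  change Φ.bar (Φ.bar (Φ.heckeMk y)) = Φ.heckeMk y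
  induction y using FreeAlgebra.induction with
  | grade0 c =>
    rw [AlgHom.commutes, bar_algebraMap, bar_algebraMap, LaurentPolynomial.involutive_invert c]
  | grade1 i => exact (congrArg Φ.bar (Φ.bar_heckeGen i)).trans (Φ.bar_heckeGen_inv i)
  | mul a b ha hb => rw [map_mul, map_mul, map_mul, ha, hb]
  | add a b ha hb => rw [map_add, map_add, map_add, ha, hb]

/-- `R = (R_{u,w})` is the family of `R`-polynomials (`R w u` stands for `R_{u,w}`):
`T_w = ∑_u v^{ℓ(u) - ℓ(w)} R_{u,w} \bar T_u` for all `w`, the sum being finite. -/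
def IsRPolynomialFamily (R : Φ.Weyl → Φ.Weyl →₀ ℤ[T;T⁻¹]) : Prop :=
  ∀ w, Φ.heckeT w = (R w).sum fun u c =>
    (LaurentPolynomial.T ((Φ.length u : ℤ) - (Φ.length w : ℤ)) * c) • Φ.bar (Φ.heckeT u)

end KacMoodyRootSystem

end

noncomputable section

namespace KacMoodyRootSystem

variable {I V : Type*} [AddCommGroup V] [Module ℝ V] (Φ : KacMoodyRootSystem I V)

/-! ### The action of the simple reflections -/

/-! Build `T_w` along a reduced expression by right multiplication by generators, and expand at each
step in the elements `bar T_u`. As `T_i = T_i⁻¹ + (v - v⁻¹)`, multiplying `bar T_u` by `T_i` gives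
`bar T_{us_i} + (v - v⁻¹) bar T_u` if `us_i` is longer than `u`, and only `bar T_{us_i}` otherwise.
Choosing one term at every step is choosing a subexpression: taking the letter costs nothing,
skipping it contributes `v - v⁻¹` and is allowed only at an ascent. This is exactly
distinguishedness. Since `σ` is reduced, the sign on the `A_0` side is always `+`, so the condition
at a skipped letter says that the current partial product sends `α_{σ_k}` to a positive root
(`isDistinguished_succ_iff`, `heckeT_eq_sum_isDistinguished`).

The translation between roots and lengths is the central fact about `W`: `wα_i` is positive if and
only if `ℓ(ws_i) > ℓ(w)`, and otherwise it is negative. It is proved by reduction to rank two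
(`inv_smul_root_mem_rootCone`). It yields the exchange condition and from it Matsumoto's theorem
(`map_prod_eq_of_isReducedWord`), by which `T_w` does not depend on the reduced expression.

Uniqueness of the coefficients needs the `bar T_u` to be linearly independent. For this the Hecke
algebra acts on the free module on `W`. The braid relations for the left operators hold because
these commute with the right operators, so that it suffices to compare values at the unit element
(`leftOp_braid`). -/

theorem s_smul (i : I) (x : V) : Φ.s i • x = x - Φ.coroot i x • Φ.root i :=
  Module.reflection_apply x (Φ.coroot_root_self i)

theorem coe_apply (w : Φ.Weyl) (x : V) : (w : V ≃ₗ[ℝ] V) x = w • x := rfl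

theorem weyl_ext {w w' : Φ.Weyl} (h : ∀ x : V, w • x = w' • x) : w = w' :=
  Subtype.ext (LinearEquiv.ext h)

theorem s_smul_root (i j : I) :
    Φ.s i • Φ.root j = Φ.root j - (Φ.cartan i j : ℝ) • Φ.root i := by
  rw [s_smul, coroot_root]

theorem s_smul_root_self (i : I) : Φ.s i • Φ.root i = -Φ.root i := by
  rw [s_smul, coroot_root_self]; module

@[simp] theorem s_mul_s (i : I) : Φ.s i * Φ.s i = 1 := by
  apply weyl_ext
  intro x
  rw [mul_smul, s_smul _ i x, smul_sub, smul_comm, s_smul_root_self, s_smul, one_smul]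
  module

@[simp] theorem s_mul_s_assoc (i : I) (w : Φ.Weyl) : Φ.s i * (Φ.s i * w) = w := by
  rw [← mul_assoc, s_mul_s, one_mul]

@[simp] theorem mul_s_mul_s (i : I) (w : Φ.Weyl) : w * Φ.s i * Φ.s i = w := by
  rw [mul_assoc, s_mul_s, mul_one]

@[simp] theorem s_inv (i : I) : (Φ.s i)⁻¹ = Φ.s i :=
  inv_eq_of_mul_eq_one_left (Φ.s_mul_s i)

/-! ### Words and lengths -/

/-- The product of a word in the simple reflections. -/
def wordProd (L : List I) : Φ.Weyl := (L.map Φ.s).prod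

@[simp] theorem wordProd_nil : Φ.wordProd [] = 1 := rfl

@[simp] theorem wordProd_cons (i : I) (L : List I) :
    Φ.wordProd (i :: L) = Φ.s i * Φ.wordProd L := by simp [wordProd]

@[simp] theorem wordProd_append (L L' : List I) :
    Φ.wordProd (L ++ L') = Φ.wordProd L * Φ.wordProd L' := by simp [wordProd]

theorem wordProd_reverse (L : List I) : Φ.wordProd L.reverse = (Φ.wordProd L)⁻¹ := by
  induction L with
  | nil => simp
  | cons i L ih => simp [ih]

theorem wordProd_ofFn {r : ℕ} (σ : Fin r → I) : Φ.wordProd (List.ofFn σ) = Φ.prod σ := by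
  rw [wordProd, prod, List.map_ofFn]; rfl

theorem length_wordProd_le (L : List I) : Φ.length (Φ.wordProd L) ≤ L.length := by
  apply Nat.sInf_le
  refine ⟨L.get, ?_⟩
  rw [← wordProd_ofFn, List.ofFn_get]

theorem exists_word (w : Φ.Weyl) : ∃ L : List I, Φ.wordProd L = w ∧ L.length = Φ.length w := by
  obtain ⟨σ, hσ⟩ := Φ.exists_reduced w
  exact ⟨List.ofFn σ, by rw [wordProd_ofFn, hσ], by simp⟩

theorem length_mul_le (w w' : Φ.Weyl) : Φ.length (w * w') ≤ Φ.length w + Φ.length w' := by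
  obtain ⟨L, rfl, hL⟩ := Φ.exists_word w
  obtain ⟨L', rfl, hL'⟩ := Φ.exists_word w'
  rw [← hL, ← hL', ← wordProd_append, ← List.length_append]
  exact Φ.length_wordProd_le _

theorem length_inv_le (w : Φ.Weyl) : Φ.length w⁻¹ ≤ Φ.length w := by
  obtain ⟨L, rfl, hL⟩ := Φ.exists_word w
  rw [← hL, ← wordProd_reverse, ← List.length_reverse]
  exact Φ.length_wordProd_le _

@[simp] theorem length_inv (w : Φ.Weyl) : Φ.length w⁻¹ = Φ.length w :=
  le_antisymm (Φ.length_inv_le w) (by simpa using Φ.length_inv_le w⁻¹)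

@[simp] theorem length_one : Φ.length (1 : Φ.Weyl) = 0 :=
  Nat.le_zero.mp (Φ.length_wordProd_le [])

theorem length_s_le (i : I) : Φ.length (Φ.s i) ≤ 1 := by
  simpa using Φ.length_wordProd_le [i]

theorem length_s_mul_le (i : I) (w : Φ.Weyl) : Φ.length (Φ.s i * w) ≤ Φ.length w + 1 := by
  have := Φ.length_mul_le (Φ.s i) w
  have := Φ.length_s_le i
  omega

theorem length_le_s_mul (i : I) (w : Φ.Weyl) : Φ.length w ≤ Φ.length (Φ.s i * w) + 1 := by
  simpa using Φ.length_s_mul_le i (Φ.s i * w)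

theorem length_mul_s (i : I) (w : Φ.Weyl) : Φ.length (w * Φ.s i) = Φ.length (Φ.s i * w⁻¹) := by
  rw [← length_inv, mul_inv_rev, s_inv]

theorem exists_length_s_mul_lt {w : Φ.Weyl} (h : w ≠ 1) :
    ∃ i, Φ.length (Φ.s i * w) < Φ.length w := by
  obtain ⟨L, rfl, hL⟩ := Φ.exists_word w
  cases L with
  | nil => exact absurd rfl h
  | cons i L =>
    refine ⟨i, ?_⟩
    rw [← hL, wordProd_cons, s_mul_s_assoc]
    exact Nat.lt_succ_of_le (Φ.length_wordProd_le L)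

/-! ### The cone of sums of simple roots -/

/-- The monoid of sums of simple roots. -/
def rootCone : AddSubmonoid V := AddSubmonoid.closure (Set.range Φ.root)

theorem root_mem_rootCone (i : I) : Φ.root i ∈ Φ.rootCone :=
  AddSubmonoid.subset_closure ⟨i, rfl⟩

/-- `V` may be larger than the span of the simple roots, so the coordinate form on the span is
extended to `V` in an arbitrary way. -/
theorem exists_coord (i : I) : ∃ f : V →ₗ[ℝ] ℝ, f (Φ.root i) = 1 ∧ ∀ j, j ≠ i → f (Φ.root j) = 0 := by
  classical
  obtain ⟨f, hf⟩ := LinearMap.exists_extend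
    ((Finsupp.lapply i : (I →₀ ℝ) →ₗ[ℝ] ℝ) ∘ₗ Φ.linearIndependent_root.repr)
  have key : ∀ j, f (Φ.root j) = Finsupp.single j (1 : ℝ) i := by
    intro j
    let x : Submodule.span ℝ (Set.range Φ.root) := ⟨Φ.root j, Submodule.subset_span ⟨j, rfl⟩⟩
    have h := LinearMap.congr_fun hf x
    rw [LinearMap.comp_apply, LinearMap.comp_apply,
      Φ.linearIndependent_root.repr_eq_single j x rfl] at h
    exact h
  exact ⟨f, by simp [key], fun j hj => by simp [key, hj]⟩

/-- The coefficient of `α_i`, extended to a linear form on `V`. -/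
def coord (i : I) : V →ₗ[ℝ] ℝ := (Φ.exists_coord i).choose

@[simp] theorem coord_root_self (i : I) : Φ.coord i (Φ.root i) = 1 :=
  (Φ.exists_coord i).choose_spec.1

theorem coord_root_of_ne {i j : I} (h : j ≠ i) : Φ.coord i (Φ.root j) = 0 :=
  (Φ.exists_coord i).choose_spec.2 j h

/-- The group of integral combinations of simple roots. -/
def rootLattice : AddSubgroup V := AddSubgroup.closure (Set.range Φ.root)

theorem root_mem_rootLattice (i : I) : Φ.root i ∈ Φ.rootLattice :=
  AddSubgroup.subset_closure ⟨i, rfl⟩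

theorem coord_int_of_mem {x : V} (hx : x ∈ Φ.rootLattice) (i : I) :
    ∃ n : ℤ, Φ.coord i x = n := by
  classical
  induction hx using AddSubgroup.closure_induction with
  | mem x hx =>
    obtain ⟨j, rfl⟩ := hx
    by_cases h : j = i
    · subst h; exact ⟨1, by simp⟩
    · exact ⟨0, by simp [Φ.coord_root_of_ne h]⟩
  | zero => exact ⟨0, by simp⟩
  | add x y _ _ hx hy =>
    obtain ⟨a, ha⟩ := hx
    obtain ⟨b, hb⟩ := hy
    exact ⟨a + b, by simp [ha, hb]⟩
  | neg x _ hx =>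
    obtain ⟨a, ha⟩ := hx
    exact ⟨-a, by simp [ha]⟩

theorem s_smul_mem_rootLattice (i : I) {x : V} (hx : x ∈ Φ.rootLattice) :
    Φ.s i • x ∈ Φ.rootLattice := by
  induction hx using AddSubgroup.closure_induction with
  | mem x hx =>
    obtain ⟨j, rfl⟩ := hx
    rw [s_smul_root, Int.cast_smul_eq_zsmul]
    exact sub_mem (Φ.root_mem_rootLattice j) (zsmul_mem (Φ.root_mem_rootLattice i) _)
  | zero => rw [smul_zero]; exact zero_mem _
  | add x y _ _ hx hy => rw [smul_add]; exact add_mem hx hy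
  | neg x _ hx => rw [smul_neg]; exact neg_mem hx

theorem smul_root_mem_rootLattice (w : Φ.Weyl) (i : I) : w • Φ.root i ∈ Φ.rootLattice := by
  obtain ⟨L, rfl, -⟩ := Φ.exists_word w
  induction L with
  | nil => simpa using Φ.root_mem_rootLattice i
  | cons j L ih => rw [wordProd_cons, mul_smul]; exact Φ.s_smul_mem_rootLattice j ih

theorem coord_nonneg {x : V} (hx : x ∈ Φ.rootCone) (i : I) : 0 ≤ Φ.coord i x := by
  classical
  induction hx using AddSubmonoid.closure_induction with
  | mem x hx =>
    obtain ⟨j, rfl⟩ := hx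
    by_cases h : j = i
    · subst h; simp
    · rw [Φ.coord_root_of_ne h]
  | zero => simp
  | add x y _ _ hx hy => rw [map_add]; exact add_nonneg hx hy

theorem mem_span_of_mem_rootCone {x : V} (hx : x ∈ Φ.rootCone) :
    x ∈ Submodule.span ℝ (Set.range Φ.root) := by
  have : Φ.rootCone ≤ (Submodule.span ℝ (Set.range Φ.root)).toAddSubmonoid :=
    (AddSubmonoid.closure_le).mpr Submodule.subset_span
  exact this hx

theorem eq_of_coord_eq {x y : V} (hx : x ∈ Submodule.span ℝ (Set.range Φ.root))
    (hy : y ∈ Submodule.span ℝ (Set.range Φ.root)) (h : ∀ i, Φ.coord i x = Φ.coord i y) :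
    x = y := by
  classical
  have key : ∀ z ∈ Submodule.span ℝ (Set.range Φ.root), (∀ i, Φ.coord i z = 0) → z = 0 := by
    intro z hz hc
    obtain ⟨c, rfl⟩ := (Finsupp.mem_span_range_iff_exists_finsupp).mp hz
    have : c = 0 := by
      ext i
      have := hc i
      rw [Finsupp.sum, map_sum, Finset.sum_eq_single i] at this
      · simpa using this
      · intro j _ hj; simp [Φ.coord_root_of_ne hj]
      · intro hi; simp [Finsupp.notMem_support_iff.mp hi]
    simp [this]
  exact sub_eq_zero.mp (key _ (sub_mem hx hy) fun i => by rw [map_sub, h, sub_self])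

theorem eq_zero_of_mem_rootCone_of_neg_mem {x : V} (hx : x ∈ Φ.rootCone)
    (hx' : -x ∈ Φ.rootCone) : x = 0 := by
  refine Φ.eq_of_coord_eq (Φ.mem_span_of_mem_rootCone hx) (zero_mem _) fun i => ?_
  have h1 := Φ.coord_nonneg hx i
  have h2 := Φ.coord_nonneg hx' i
  rw [map_neg] at h2
  rw [map_zero]
  linarith

theorem smul_root_ne_zero (w : Φ.Weyl) (i : I) : w • Φ.root i ≠ 0 := by
  intro h
  have h0 : Φ.root i = 0 := by
    have := congrArg (fun x => w⁻¹ • x) h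
    simpa using this
  have := Φ.coord_root_self i
  rw [h0, map_zero] at this
  exact zero_ne_one this

/-! ### Alternating products of involutions -/

/-- Conjugation by the involution `a` inverts `ab`, whence `(ab)^m a (ab)^m = a`; this moves the
powers of `ab` past a leading `a`. -/
theorem altProd_eq_pow_mul {G : Type*} [Group G] (n : ℕ) : ∀ {a b : G}, a * a = 1 → b * b = 1 →
    altProd a b n = (a * b) ^ n * altProd b a n := by
  induction n with
  | zero => intro a b _ _; simp [altProd]
  | succ n ih =>
    intro a b ha hb
    have h1 : ∀ m, (a * b) ^ m * a * (a * b) ^ m = a := by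
      intro m
      induction m with
      | zero => simp
      | succ m ihm =>
        calc (a * b) ^ (m + 1) * a * (a * b) ^ (m + 1)
            = a * b * ((a * b) ^ m * a * (a * b) ^ m) * (a * b) := by
              rw [pow_succ' (a * b) m]; nth_rewrite 2 [← pow_succ']; rw [pow_succ]
              simp only [mul_assoc]
          _ = a := by rw [ihm, mul_assoc, mul_assoc, ← mul_assoc a a b, ha, one_mul, hb, mul_one]
    calc altProd a b (n + 1) = a * altProd b a n := rfl
      _ = (a * b) ^ n * a * (a * b) ^ n * altProd b a n := by rw [h1]
      _ = (a * b) ^ n * a * altProd a b n := by rw [ih ha hb]; simp only [mul_assoc]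
      _ = (a * b) ^ n * a * (b * b) * altProd a b n := by rw [hb, mul_one]
      _ = (a * b) ^ (n + 1) * altProd b a (n + 1) := by
        rw [pow_succ, altProd]; simp only [mul_assoc]

theorem altProd_comm_of_pow_eq_one {G : Type*} [Group G] {n : ℕ} {a b : G} (ha : a * a = 1)
    (hb : b * b = 1) (h : (a * b) ^ n = 1) : altProd a b n = altProd b a n := by
  rw [altProd_eq_pow_mul n ha hb, h, one_mul]

/-- The last factor is `a` or `b` according to parity; `x` either cancels it or continues the
alternation. -/
theorem altProd_mul_or {G : Type*} [Group G] {a b x : G} (ha : a * a = 1) (hb : b * b = 1)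
    (hx : x = a ∨ x = b) (n : ℕ) :
    altProd a b (n + 1) * x = altProd a b (n + 2) ∨ altProd a b (n + 1) * x = altProd a b n := by
  by_cases h : Even n
  · rcases hx with rfl | rfl
    · right; rw [altProd_succ', if_pos h, mul_assoc, ha, mul_one]
    · left; rw [altProd_succ' (n + 1), if_neg (by simpa [Nat.even_add_one] using h)]
  · rcases hx with rfl | rfl
    · left; rw [altProd_succ' (n + 1), if_pos (by simpa [Nat.even_add_one] using h)]
    · right; rw [altProd_succ', if_neg h, mul_assoc, hb, mul_one]

theorem orderOf_s_mul_comm (i j : I) : orderOf (Φ.s i * Φ.s j) = orderOf (Φ.s j * Φ.s i) := by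
  rw [← orderOf_inv, mul_inv_rev, s_inv, s_inv]

theorem s_braid (i j : I) : altProd (Φ.s i) (Φ.s j) (orderOf (Φ.s i * Φ.s j)) =
    altProd (Φ.s j) (Φ.s i) (orderOf (Φ.s i * Φ.s j)) :=
  altProd_comm_of_pow_eq_one (Φ.s_mul_s i) (Φ.s_mul_s j) (pow_orderOf_eq_one _)

/-! ### Root subsystems of rank two -/

/-- The coefficients obtained from `(p, q)` by applying alternatingly `n` simple reflections of
a root system of rank two with Cartan integers `-a`, `-b`. -/
def rankTwoCoeff : ℕ → ℤ → ℤ → ℤ → ℤ → ℤ × ℤ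
  | 0, _, _, p, q => (p, q)
  | n + 1, a, b, p, q => rankTwoCoeff n b a (b * p - q) p

theorem altProd_inv_smul_of_coeff_nonneg (n : ℕ) : ∀ (i j : I) (p q : ℤ),
    0 ≤ (rankTwoCoeff n (-Φ.cartan i j) (-Φ.cartan j i) p q).1 →
    0 ≤ (rankTwoCoeff n (-Φ.cartan i j) (-Φ.cartan j i) p q).2 →
    ∃ P Q : ℕ, (altProd (Φ.s j) (Φ.s i) n)⁻¹ • ((p : ℝ) • Φ.root i + (q : ℝ) • Φ.root j) =
      P • Φ.root i + Q • Φ.root j := by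
  induction n with
  | zero =>
    intro i j p q hp hq
    obtain ⟨P, rfl⟩ := Int.eq_ofNat_of_zero_le hp
    obtain ⟨Q, rfl⟩ := Int.eq_ofNat_of_zero_le hq
    exact ⟨P, Q, by simp [altProd, Nat.cast_smul_eq_nsmul]⟩
  | succ n ih =>
    intro i j p q hp hq
    obtain ⟨P, Q, h⟩ := ih j i _ _ hp hq
    -- In the inverse, `s_j` acts first: it replaces the coefficient `q` of `α_j` by `bp - q`, where
    -- `b = -a_{ji}`. Then the two roots exchange roles, hence the swap.
    refine ⟨Q, P, ?_⟩
    rw [altProd, mul_inv_rev, mul_smul, s_inv, add_comm (Q • _), ← h]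
    congr 1
    rw [smul_add, smul_comm, smul_comm (Φ.s j) (q : ℝ), s_smul_root_self, s_smul_root]
    push_cast
    module

/-- The inequality `2q ≤ bp` is an invariant: it gives `bp - q ≥ 0`, and with `ab ≥ 4` also `a(bp -
q) ≥ abp/2 ≥ 2p`. -/
theorem rankTwoCoeff_nonneg_of_four_le (n : ℕ) : ∀ (a b p q : ℤ), 0 ≤ a → 0 ≤ b → 4 ≤ a * b →
    0 ≤ p → 0 ≤ q → 2 * q ≤ b * p →
    0 ≤ (rankTwoCoeff n a b p q).1 ∧ 0 ≤ (rankTwoCoeff n a b p q).2 := by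
  induction n with
  | zero => intro a b p q _ _ _ hp hq _; exact ⟨hp, hq⟩
  | succ n ih =>
    intro a b p q ha hb hab hp hq h
    refine ih b a _ _ hb ha (by linarith [mul_comm a b]) (by linarith) hp ?_
    nlinarith [mul_le_mul_of_nonneg_left h ha, mul_le_mul_of_nonneg_right hab hp]

/-- On `x + ℝα_i + ℝα_j` the product acts by an affine map of the two coefficients; iterating it
bounds the order of `s_i s_j` on all of `V`. -/
theorem s_mul_s_smul (i j : I) (x : V) (P Q : ℝ) :
    (Φ.s i * Φ.s j) • (x + P • Φ.root i + Q • Φ.root j) =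
      x + (-P - Φ.coroot i x - Φ.cartan i j * (-Q - Φ.coroot j x - Φ.cartan j i * P)) • Φ.root i +
        (-Q - Φ.coroot j x - Φ.cartan j i * P) • Φ.root j := by
  rw [mul_smul, s_smul _ j, s_smul _ i]
  simp only [map_add, map_sub, map_smul, coroot_root, cartan_diag, smul_eq_mul]
  push_cast
  module

theorem cartan_cases {i j : I} (hij : i ≠ j) :
    4 ≤ -Φ.cartan i j * -Φ.cartan j i ∨ (Φ.cartan i j = 0 ∧ Φ.cartan j i = 0) ∨
    (Φ.cartan i j = -1 ∧ Φ.cartan j i = -1) ∨ (Φ.cartan i j = -1 ∧ Φ.cartan j i = -2) ∨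
    (Φ.cartan i j = -2 ∧ Φ.cartan j i = -1) ∨ (Φ.cartan i j = -1 ∧ Φ.cartan j i = -3) ∨
    (Φ.cartan i j = -3 ∧ Φ.cartan j i = -1) := by
  have h1 := Φ.cartan_offDiag i j hij
  have h2 := Φ.cartan_offDiag j i hij.symm
  have h3 := Φ.cartan_zero i j
  have h4 := Φ.cartan_zero j i
  generalize Φ.cartan i j = a at *
  generalize Φ.cartan j i = b at *
  by_cases ha : a = 0
  · simp [ha, h3 ha]
  by_cases hb : b = 0
  · exact absurd (h4 hb) ha
  by_cases h : 4 ≤ -a * -b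
  · exact Or.inl h
  have ha' : -3 ≤ a := by by_contra; apply h; nlinarith [show a ≤ -4 by omega, show b ≤ -1 by omega]
  have hb' : -3 ≤ b := by by_contra; apply h; nlinarith [show b ≤ -4 by omega, show a ≤ -1 by omega]
  interval_cases a <;> interval_cases b <;> simp_all

/-- Simple reflections with Cartan integers `-a`, `-b` have a product of order dividing `m`. -/
theorem s_mul_s_pow_eq_one {i j : I} {m : ℕ}
    (h : ∀ (x : V) , ((fun c : ℝ × ℝ =>
      (-c.1 - Φ.coroot i x - Φ.cartan i j * (-c.2 - Φ.coroot j x - Φ.cartan j i * c.1),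
        -c.2 - Φ.coroot j x - Φ.cartan j i * c.1))^[m] (0, 0)) = (0, 0)) :
    (Φ.s i * Φ.s j) ^ m = 1 := by
  apply weyl_ext
  intro x
  have key : ∀ n : ℕ, ∀ c, c = ((fun c : ℝ × ℝ =>
      (-c.1 - Φ.coroot i x - Φ.cartan i j * (-c.2 - Φ.coroot j x - Φ.cartan j i * c.1),
        -c.2 - Φ.coroot j x - Φ.cartan j i * c.1))^[n] (0, 0)) →
      (Φ.s i * Φ.s j) ^ n • x = x + c.1 • Φ.root i + c.2 • Φ.root j := by
    intro n
    induction n with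
    | zero => rintro c rfl; simp
    | succ n ih =>
      rintro c rfl
      rw [pow_succ', mul_smul, ih _ rfl, s_mul_s_smul, Function.iterate_succ_apply']
  rw [key m _ rfl, h x]
  simp

theorem exists_rankTwoCoeff_bound {i j : I} (hij : i ≠ j) : ∀ n,
    orderOf (Φ.s i * Φ.s j) = 0 ∨ n < orderOf (Φ.s i * Φ.s j) →
    0 ≤ (rankTwoCoeff n (-Φ.cartan i j) (-Φ.cartan j i) 1 0).1 ∧
    0 ≤ (rankTwoCoeff n (-Φ.cartan i j) (-Φ.cartan j i) 1 0).2 := by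
  -- For Cartan products 0, 1, 2, 3 the exact order is not needed: `(s_i s_j)^m = 1` with `m` = 2,
  -- 3, 4, 6 makes the order positive and at most `m`, which leaves finitely many `n` to check.
  have fin : ∀ (a b : ℤ) (m : ℕ), 0 < m → (Φ.s i * Φ.s j) ^ m = 1 →
      (∀ n < m, 0 ≤ (rankTwoCoeff n a b 1 0).1 ∧ 0 ≤ (rankTwoCoeff n a b 1 0).2) → ∀ n,
      orderOf (Φ.s i * Φ.s j) = 0 ∨ n < orderOf (Φ.s i * Φ.s j) →
      0 ≤ (rankTwoCoeff n a b 1 0).1 ∧ 0 ≤ (rankTwoCoeff n a b 1 0).2 := by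
    intro a b m hm h1 h2 n hn
    have h3 := orderOf_le_of_pow_eq_one hm h1
    have h4 := (orderOf_pos_iff.mpr (isOfFinOrder_iff_pow_eq_one.mpr ⟨m, hm, h1⟩))
    exact h2 n (by omega)
  rcases Φ.cartan_cases hij with h | h | h | h | h | h | h
  · intro n _
    refine rankTwoCoeff_nonneg_of_four_le n _ _ 1 0 ?_ ?_ h zero_le_one le_rfl ?_
    · have := Φ.cartan_offDiag i j hij; omega
    · have := Φ.cartan_offDiag j i hij.symm; omega
    · have := Φ.cartan_offDiag j i hij.symm; omega
  · rw [h.1, h.2]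
    refine fin _ _ 2 (by norm_num) (Φ.s_mul_s_pow_eq_one fun x => ?_) (by decide)
    simp only [h.1, h.2, Function.iterate_succ_apply', Function.iterate_zero_apply, Prod.mk.injEq]
    push_cast; constructor <;> ring
  · rw [h.1, h.2]
    refine fin _ _ 3 (by norm_num) (Φ.s_mul_s_pow_eq_one fun x => ?_) (by decide)
    simp only [h.1, h.2, Function.iterate_succ_apply', Function.iterate_zero_apply, Prod.mk.injEq]
    push_cast; constructor <;> ring
  · rw [h.1, h.2]
    refine fin _ _ 4 (by norm_num) (Φ.s_mul_s_pow_eq_one fun x => ?_) (by decide)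
    simp only [h.1, h.2, Function.iterate_succ_apply', Function.iterate_zero_apply, Prod.mk.injEq]
    push_cast; constructor <;> ring
  · rw [h.1, h.2]
    refine fin _ _ 4 (by norm_num) (Φ.s_mul_s_pow_eq_one fun x => ?_) (by decide)
    simp only [h.1, h.2, Function.iterate_succ_apply', Function.iterate_zero_apply, Prod.mk.injEq]
    push_cast; constructor <;> ring
  · rw [h.1, h.2]
    refine fin _ _ 6 (by norm_num) (Φ.s_mul_s_pow_eq_one fun x => ?_) (by decide)
    simp only [h.1, h.2, Function.iterate_succ_apply', Function.iterate_zero_apply, Prod.mk.injEq]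
    push_cast; constructor <;> ring
  · rw [h.1, h.2]
    refine fin _ _ 6 (by norm_num) (Φ.s_mul_s_pow_eq_one fun x => ?_) (by decide)
    simp only [h.1, h.2, Function.iterate_succ_apply', Function.iterate_zero_apply, Prod.mk.injEq]
    push_cast; constructor <;> ring

theorem altProd_inv_smul_root {i j : I} (hij : i ≠ j) {n : ℕ}
    (hn : orderOf (Φ.s i * Φ.s j) = 0 ∨ n < orderOf (Φ.s i * Φ.s j)) :
    ∃ P Q : ℕ, (altProd (Φ.s j) (Φ.s i) n)⁻¹ • Φ.root i = P • Φ.root i + Q • Φ.root j := by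
  have h := Φ.exists_rankTwoCoeff_bound hij n hn
  simpa using Φ.altProd_inv_smul_of_coeff_nonneg n i j 1 0 h.1 h.2

theorem length_altProd_le (n : ℕ) : ∀ i j : I, Φ.length (altProd (Φ.s i) (Φ.s j) n) ≤ n := by
  induction n with
  | zero => intro i j; simp [altProd]
  | succ n ih => intro i j; exact (Φ.length_s_mul_le _ _).trans (Nat.succ_le_succ (ih j i))

/-- At `n = m_{ij}` the braid relation makes the word start with `s_i`, which cancels; each later
letter adds at most one to the length. -/
theorem length_s_mul_altProd_lt (i j : I) {n : ℕ} (h0 : 0 < orderOf (Φ.s i * Φ.s j))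
    (hn : orderOf (Φ.s i * Φ.s j) ≤ n) :
    Φ.length (Φ.s i * altProd (Φ.s j) (Φ.s i) n) < n := by
  induction n, hn using Nat.le_induction with
  | base =>
    rw [← s_braid]
    obtain ⟨m, hm⟩ := Nat.exists_eq_succ_of_ne_zero h0.ne'
    rw [hm, altProd, s_mul_s_assoc]
    exact Nat.lt_succ_of_le (Φ.length_altProd_le m j i)
  | succ n _ ih =>
    have hlen : ∀ (w : Φ.Weyl) k, Φ.length (w * Φ.s k) ≤ Φ.length w + 1 := fun w k => by
      have := Φ.length_mul_le w (Φ.s k)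
      have := Φ.length_s_le k
      omega
    rw [altProd_succ', ← mul_assoc]
    split_ifs
    · exact (hlen _ _).trans_lt (by omega)
    · exact (hlen _ _).trans_lt (by omega)

/-! ### Positivity of roots -/

/-- Split `w = xv` with `x` in the dihedral group of `s_i, s_j` and `v` having neither `s_i` nor
`s_j` as a left descent. Then `x⁻¹α_i` is a nonnegative combination of `α_i, α_j` by rank two, and
`v⁻¹` keeps both positive by induction on the length. -/
theorem inv_smul_root_mem_rootCone (n : ℕ) : ∀ (w : Φ.Weyl) (i : I), Φ.length w = n →
    Φ.length w ≤ Φ.length (Φ.s i * w) → w⁻¹ • Φ.root i ∈ Φ.rootCone := by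
  induction n using Nat.strong_induction_on with
  | _ n ih =>
  intro w i hw hi
  by_cases hw1 : w = 1
  · subst hw1; simpa using Φ.root_mem_rootCone i
  obtain ⟨j, hj⟩ := Φ.exists_length_s_mul_lt hw1
  have hij : i ≠ j := by rintro rfl; omega
  let Q : ℕ → Prop := fun k => ∃ v, w = altProd (Φ.s j) (Φ.s i) (k + 1) * v ∧
    k + 1 + Φ.length v = Φ.length w
  classical
  have hQ0 : Q 0 := by
    refine ⟨Φ.s j * w, by simp [altProd], ?_⟩
    have := Φ.length_le_s_mul j w
    omega
  have hQle : ∀ k, Q k → k ≤ n := by rintro k ⟨v, -, h⟩; omega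
  obtain ⟨v, hv, hvl⟩ := Nat.findGreatest_spec (P := Q) (Nat.zero_le n) hQ0
  have hmax : ¬ Q (Nat.findGreatest Q n + 1) := fun h => by
    have := Nat.le_findGreatest (hQle _ h) h
    omega
  set k := Nat.findGreatest Q n
  -- If `s_x` shortened `v`, moving it into the alternating factor would either lengthen that
  -- factor, against maximality of `k`, or shorten it, against the length of `w`.
  have hmin : ∀ x, x = i ∨ x = j → Φ.length v ≤ Φ.length (Φ.s x * v) := by
    intro x hx
    by_contra! hlt
    have hw' : w = altProd (Φ.s j) (Φ.s i) (k + 1) * Φ.s x * (Φ.s x * v) := by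
      rw [hv, mul_assoc, s_mul_s_assoc]
    have hx' : Φ.s x = Φ.s j ∨ Φ.s x = Φ.s i := by rcases hx with rfl | rfl <;> simp
    rcases altProd_mul_or (Φ.s_mul_s j) (Φ.s_mul_s i) hx' k with h | h
    · rw [h] at hw'
      refine hmax ⟨_, hw', ?_⟩
      have h1 := Φ.length_mul_le (altProd (Φ.s j) (Φ.s i) (k + 2)) (Φ.s x * v)
      have h2 := Φ.length_altProd_le (k + 2) j i
      rw [← hw'] at h1
      omega
    · rw [h] at hw'
      have h1 := Φ.length_mul_le (altProd (Φ.s j) (Φ.s i) k) (Φ.s x * v)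
      have h2 := Φ.length_altProd_le k j i
      rw [← hw'] at h1
      omega
  have hi' := ih (Φ.length v) (by omega) v i rfl (hmin i (Or.inl rfl))
  have hj' := ih (Φ.length v) (by omega) v j rfl (hmin j (Or.inr rfl))
  -- An alternating factor as long as the order of `s_i s_j` would make `s_i` a left descent of `w`.
  have hk : orderOf (Φ.s i * Φ.s j) = 0 ∨ k + 1 < orderOf (Φ.s i * Φ.s j) := by
    by_contra! hcon
    have h1 := Φ.length_s_mul_altProd_lt i j (Nat.pos_of_ne_zero hcon.1) hcon.2
    have h2 := Φ.length_mul_le (Φ.s i * altProd (Φ.s j) (Φ.s i) (k + 1)) v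
    rw [mul_assoc, ← hv] at h2
    omega
  obtain ⟨P, R, h⟩ := Φ.altProd_inv_smul_root hij hk
  rw [hv, mul_inv_rev, mul_smul, h, smul_add, smul_comm v⁻¹ P, smul_comm v⁻¹ R]
  exact add_mem (nsmul_mem hi' _) (nsmul_mem hj' _)

theorem smul_root_not_mem_of_neg_mem {w : Φ.Weyl} {i : I} (h : -(w • Φ.root i) ∈ Φ.rootCone) :
    w • Φ.root i ∉ Φ.rootCone := fun h' =>
  Φ.smul_root_ne_zero w i (Φ.eq_zero_of_mem_rootCone_of_neg_mem h' h)

theorem neg_inv_smul_root_mem_rootCone {w : Φ.Weyl} {i : I}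
    (h : Φ.length (Φ.s i * w) ≤ Φ.length w) : -(w⁻¹ • Φ.root i) ∈ Φ.rootCone := by
  have := Φ.inv_smul_root_mem_rootCone _ (Φ.s i * w) i rfl (by rwa [s_mul_s_assoc])
  rwa [mul_inv_rev, s_inv, mul_smul, s_smul_root_self, smul_neg] at this

theorem inv_smul_root_mem_rootCone_iff {w : Φ.Weyl} {i : I} :
    w⁻¹ • Φ.root i ∈ Φ.rootCone ↔ Φ.length w < Φ.length (Φ.s i * w) := by
  refine ⟨fun h => ?_, fun h => Φ.inv_smul_root_mem_rootCone _ w i rfl h.le⟩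
  by_contra! hle
  exact Φ.smul_root_not_mem_of_neg_mem (Φ.neg_inv_smul_root_mem_rootCone hle) h

theorem smul_root_mem_rootCone_iff {w : Φ.Weyl} {i : I} :
    w • Φ.root i ∈ Φ.rootCone ↔ Φ.length w < Φ.length (w * Φ.s i) := by
  have := Φ.inv_smul_root_mem_rootCone_iff (w := w⁻¹) (i := i)
  rwa [inv_inv, length_inv, ← length_mul_s] at this

theorem smul_root_mem_or (w : Φ.Weyl) (i : I) :
    w • Φ.root i ∈ Φ.rootCone ∨ -(w • Φ.root i) ∈ Φ.rootCone := by
  rcases le_total (Φ.length w⁻¹) (Φ.length (Φ.s i * w⁻¹)) with h | h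
  · left; simpa using Φ.inv_smul_root_mem_rootCone _ w⁻¹ i rfl h
  · right; simpa using Φ.neg_inv_smul_root_mem_rootCone h

theorem neg_smul_root_mem_rootCone_iff {w : Φ.Weyl} {i : I} :
    -(w • Φ.root i) ∈ Φ.rootCone ↔ w • Φ.root i ∉ Φ.rootCone :=
  ⟨Φ.smul_root_not_mem_of_neg_mem, (Φ.smul_root_mem_or w i).resolve_left⟩

/-! ### The positive roots and their negatives as orientations -/

theorem mem_posRoots_iff {β : V} : β ∈ Φ.posRoots ↔ β ∈ Φ.roots ∧ β ∈ Φ.rootCone := Iff.rfl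

theorem smul_root_mem_roots (w : Φ.Weyl) (i : I) : w • Φ.root i ∈ Φ.roots := ⟨w, i, rfl⟩

theorem neg_mem_roots {β : V} (h : β ∈ Φ.roots) : -β ∈ Φ.roots := by
  obtain ⟨w, i, rfl⟩ := h
  refine ⟨w * Φ.s i, i, ?_⟩
  rw [coe_apply, coe_apply, mul_smul, s_smul_root_self, smul_neg]

theorem isOrientation_posRoots : Φ.IsOrientation Φ.posRoots where
  union := by
    ext β
    simp only [Set.mem_union, Set.mem_neg, mem_posRoots_iff]
    constructor
    · rintro (h | h)
      · exact h.1
      · simpa using Φ.neg_mem_roots h.1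
    · intro h
      have h' := Φ.neg_mem_roots h
      obtain ⟨w, i, rfl⟩ := h
      exact (Φ.smul_root_mem_or w i).imp (fun hh => ⟨⟨w, i, rfl⟩, hh⟩) (fun hh => ⟨h', hh⟩)
  disjoint := by
    rw [Set.disjoint_left]
    rintro β ⟨⟨w, i, rfl⟩, h⟩ ⟨-, h'⟩
    exact Φ.smul_root_not_mem_of_neg_mem h' h
  convex := by
    rintro α ⟨-, hα⟩ β ⟨-, hβ⟩ a b ha hb hab
    refine ⟨hab, ?_⟩
    obtain ⟨w, i, h⟩ := hab
    rw [coe_apply] at h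
    rw [h]
    -- Real coefficients `a, b` need not preserve the monoid of integral sums. But the combination
    -- is a root, so it or its negative lies there, and in the second case all coordinates vanish.
    refine (Φ.smul_root_mem_or w i).resolve_right fun hneg => Φ.smul_root_ne_zero w i ?_
    rw [← neg_eq_zero]
    refine Φ.eq_of_coord_eq (Φ.mem_span_of_mem_rootCone hneg) (zero_mem _) fun k => ?_
    have h1 := Φ.coord_nonneg hneg k
    have h2 := mul_nonneg ha.le (Φ.coord_nonneg hα k)
    have h3 := mul_nonneg hb.le (Φ.coord_nonneg hβ k)
    rw [← h] at h1 ⊢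
    simp only [map_neg, map_add, map_smul, smul_eq_mul, map_zero] at h1 ⊢
    linarith

theorem IsOrientation.neg {P : Set V} (h : Φ.IsOrientation P) : Φ.IsOrientation (-P) where
  union := by rw [neg_neg, Set.union_comm, h.union]
  disjoint := by rw [neg_neg]; exact h.disjoint.symm
  convex := by
    intro α hα β hβ a b ha hb hab
    have hab' : a • -α + b • -β ∈ Φ.roots := by
      have := Φ.neg_mem_roots hab
      rwa [neg_add, ← smul_neg, ← smul_neg] at this
    have := h.convex (-α) hα (-β) hβ a b ha hb hab'
    rw [Set.mem_neg, neg_add, ← smul_neg, ← smul_neg]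
    exact this

/-! ### The exchange condition -/

theorem eq_one_of_forall_smul_root_mem {w : Φ.Weyl} (h : ∀ i, w • Φ.root i ∈ Φ.rootCone) :
    w = 1 := by
  by_contra hw
  obtain ⟨i, hi⟩ := Φ.exists_length_s_mul_lt (w := w⁻¹) (by simpa using hw)
  rw [← length_mul_s, length_inv] at hi
  exact absurd (Φ.smul_root_mem_rootCone_iff.mp (h i)) (not_lt.mpr hi.le)

/-- Both `w s_i w⁻¹` and `s_j` negate `α_j` and move vectors only along `α_j`. Their product
therefore fixes `α_j` and keeps the coefficient 1 of `α_k` in the image of every other `α_k`; so it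
makes no simple root negative and is trivial. -/
theorem mul_s_eq_s_mul_of_smul_root_eq {w : Φ.Weyl} {i j : I} (h : w • Φ.root i = Φ.root j) :
    w * Φ.s i = Φ.s j * w := by
  have hinv : w⁻¹ • Φ.root j = Φ.root i := by rw [← h, inv_smul_smul]
  have h1 : w * Φ.s i * w⁻¹ * Φ.s j = 1 := by
    refine Φ.eq_one_of_forall_smul_root_mem fun k => ?_
    have hu : ∀ y : V, (w * Φ.s i * w⁻¹) • y = y - Φ.coroot i (w⁻¹ • y) • Φ.root j := by
      intro y
      rw [mul_smul, mul_smul, s_smul, smul_sub, smul_inv_smul, smul_comm, h]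
    by_cases hk : k = j
    · subst hk
      rw [mul_smul, s_smul_root_self, hu, smul_neg, hinv, map_neg, coroot_root_self]
      convert Φ.root_mem_rootCone k using 1
      module
    · refine (Φ.smul_root_mem_or _ k).resolve_right fun hneg => ?_
      have := Φ.coord_nonneg hneg k
      rw [mul_smul, hu, s_smul_root] at this
      simp only [map_neg, map_sub, map_smul, coord_root_self,
        Φ.coord_root_of_ne (Ne.symm hk), smul_zero, sub_zero] at this
      linarith
  rw [← one_mul (Φ.s j), ← h1]
  simp

/-- `s_j` changes only the `α_j`-coefficient, so a sign change forces `wα_i = cα_j` with `c ≥ 0`.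
Integrality of the coefficients of `w⁻¹α_j` makes `c` a unit. -/
theorem smul_root_eq_of_neg_s_smul_mem {w : Φ.Weyl} {i j : I} (h : w • Φ.root i ∈ Φ.rootCone)
    (h' : (Φ.s j * w) • Φ.root i ∉ Φ.rootCone) : w • Φ.root i = Φ.root j := by
  have hneg := (Φ.smul_root_mem_or _ _).resolve_left h'
  obtain ⟨c, hc⟩ := Φ.coord_int_of_mem (Φ.smul_root_mem_rootLattice w i) j
  have heq : w • Φ.root i = (c : ℝ) • Φ.root j := by
    refine Φ.eq_of_coord_eq (Φ.mem_span_of_mem_rootCone h)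
      (Submodule.smul_mem _ _ (Submodule.subset_span ⟨j, rfl⟩)) fun k => ?_
    by_cases hk : k = j
    · subst hk; simp [hc]
    · have h1 := Φ.coord_nonneg h k
      have h2 := Φ.coord_nonneg hneg k
      rw [mul_smul, s_smul] at h2
      simp only [map_neg, map_sub, map_smul, Φ.coord_root_of_ne (Ne.symm hk), smul_zero,
        sub_zero] at h2 ⊢
      linarith
  obtain ⟨d, hd⟩ := Φ.coord_int_of_mem (Φ.smul_root_mem_rootLattice w⁻¹ j) i
  have h1 : (1 : ℝ) = c * d := by
    have := congrArg (fun x => Φ.coord i (w⁻¹ • x)) heq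
    simpa [smul_comm w⁻¹ (c : ℝ), hd] using this
  have h2 : c * d = 1 := by exact_mod_cast h1.symm
  have hc0 : 0 ≤ c := by
    have := Φ.coord_nonneg h j
    rw [hc] at this
    exact_mod_cast this
  have hc1 : c = 1 := Int.eq_one_of_dvd_one hc0 ⟨d, h2.symm⟩
  rw [heq, hc1, Int.cast_one, one_smul]

/-- Apply the letters to `α_i` from the right. Where the root first turns negative it was the simple
root of that letter, and moving `s_i` through to this place deletes the letter. -/
theorem exchange_right (L : List I) (i : I) (h : Φ.wordProd L • Φ.root i ∉ Φ.rootCone) :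
    ∃ L₁ j L₂, L = L₁ ++ j :: L₂ ∧ Φ.wordProd L * Φ.s i = Φ.wordProd (L₁ ++ L₂) := by
  induction L with
  | nil => exact absurd (by simpa using Φ.root_mem_rootCone i) h
  | cons j L ih =>
    by_cases hL : Φ.wordProd L • Φ.root i ∈ Φ.rootCone
    · refine ⟨[], j, L, rfl, ?_⟩
      rw [wordProd_cons] at h ⊢
      rw [mul_assoc, Φ.mul_s_eq_s_mul_of_smul_root_eq (Φ.smul_root_eq_of_neg_s_smul_mem hL h),
        s_mul_s_assoc, List.nil_append]
    · obtain ⟨L₁, k, L₂, rfl, h'⟩ := ih hL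
      refine ⟨j :: L₁, k, L₂, rfl, ?_⟩
      rw [wordProd_cons, mul_assoc, h', List.cons_append, wordProd_cons]

theorem exchange_left (L : List I) (i : I)
    (h : Φ.length (Φ.s i * Φ.wordProd L) ≤ Φ.length (Φ.wordProd L)) :
    ∃ L₁ j L₂, L = L₁ ++ j :: L₂ ∧ Φ.s i * Φ.wordProd L = Φ.wordProd (L₁ ++ L₂) := by
  obtain ⟨L₁, j, L₂, hL, h'⟩ := Φ.exchange_right L.reverse i (by
    rw [wordProd_reverse, inv_smul_root_mem_rootCone_iff]; exact not_lt.mpr h)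
  refine ⟨L₂.reverse, j, L₁.reverse, ?_, ?_⟩
  · rw [← List.reverse_reverse L, hL]; simp
  · rw [← List.reverse_append, wordProd_reverse, ← h', wordProd_reverse]; simp

/-- Multiplying on the left by a simple reflection does not change right descents, unless it
amounts to multiplying on the right by a simple reflection. -/
theorem length_lt_mul_s_iff (i j : I) (w : Φ.Weyl) (h : Φ.s i * w ≠ w * Φ.s j) :
    Φ.length (Φ.s i * w) < Φ.length (Φ.s i * w * Φ.s j) ↔ Φ.length w < Φ.length (w * Φ.s j) := by
  rw [← smul_root_mem_rootCone_iff, ← smul_root_mem_rootCone_iff]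
  constructor
  · intro h1
    by_contra h2
    have := Φ.mul_s_eq_s_mul_of_smul_root_eq
      (Φ.smul_root_eq_of_neg_s_smul_mem (j := i) h1 (by rwa [s_mul_s_assoc]))
    rw [s_mul_s_assoc] at this
    exact h (by simpa [mul_assoc] using (congrArg (Φ.s i * ·) this).symm)
  · intro h1
    by_contra h2
    exact h (Φ.mul_s_eq_s_mul_of_smul_root_eq (Φ.smul_root_eq_of_neg_s_smul_mem h1 h2)).symm

theorem length_lt_s_mul_iff (i j : I) (w : Φ.Weyl) (h : Φ.s i * w ≠ w * Φ.s j) :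
    Φ.length (w * Φ.s j) < Φ.length (Φ.s i * w * Φ.s j) ↔ Φ.length w < Φ.length (Φ.s i * w) := by
  have := Φ.length_lt_mul_s_iff j i w⁻¹ (fun h' => h (by
    have := congrArg (fun x => x⁻¹) h'
    simpa using this.symm))
  rw [← length_inv _ (Φ.s j * w⁻¹), ← length_inv _ (Φ.s j * w⁻¹ * Φ.s i),
    ← length_inv _ (w⁻¹ * Φ.s i), length_inv _ w] at this
  simpa [mul_assoc] using this

/-- Equal lengths cannot occur: `w⁻¹α_i` is positive or negative, and replacing `w` by `s_i w`
changes its sign. -/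
theorem length_s_mul_lt_iff (i : I) (w : Φ.Weyl) :
    Φ.length (Φ.s i * w) < Φ.length w ↔ ¬ Φ.length w < Φ.length (Φ.s i * w) := by
  refine ⟨fun h => not_lt.mpr h.le, fun h => ?_⟩
  rw [← inv_smul_root_mem_rootCone_iff, ← neg_smul_root_mem_rootCone_iff] at h
  have := (Φ.inv_smul_root_mem_rootCone_iff (w := Φ.s i * w) (i := i)).mp (by
    rwa [mul_inv_rev, s_inv, mul_smul, s_smul_root_self, smul_neg])
  rwa [s_mul_s_assoc] at this

theorem length_mul_s_lt_iff (i : I) (w : Φ.Weyl) :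
    Φ.length (w * Φ.s i) < Φ.length w ↔ ¬ Φ.length w < Φ.length (w * Φ.s i) := by
  have := Φ.length_s_mul_lt_iff i w⁻¹
  rwa [← length_mul_s, length_inv] at this

theorem length_mul_s_le (i : I) (w : Φ.Weyl) : Φ.length (w * Φ.s i) ≤ Φ.length w + 1 := by
  rw [length_mul_s, ← length_inv _ w]
  exact Φ.length_s_mul_le i w⁻¹

theorem length_altProd {i j : I} (hij : i ≠ j) {n : ℕ}
    (hn : orderOf (Φ.s i * Φ.s j) = 0 ∨ n ≤ orderOf (Φ.s i * Φ.s j)) :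
    Φ.length (altProd (Φ.s i) (Φ.s j) n) = n := by
  induction n generalizing i j with
  | zero => simp [altProd]
  | succ n ih =>
    have h1 := ih hij.symm (by rw [orderOf_s_mul_comm]; omega)
    obtain ⟨P, Q, h⟩ := Φ.altProd_inv_smul_root hij (n := n) (by omega)
    have h2 : (altProd (Φ.s j) (Φ.s i) n)⁻¹ • Φ.root i ∈ Φ.rootCone := by
      rw [h]
      exact add_mem (nsmul_mem (Φ.root_mem_rootCone i) _) (nsmul_mem (Φ.root_mem_rootCone j) _)
    rw [inv_smul_root_mem_rootCone_iff] at h2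
    have h3 := Φ.length_s_mul_le i (altProd (Φ.s j) (Φ.s i) n)
    rw [altProd]
    omega

/-! ### Matsumoto's theorem -/

/-- The alternating word `i j i ⋯` with `n` letters. -/
def altWord (i j : I) : ℕ → List I
  | 0 => []
  | n + 1 => i :: altWord j i n

theorem map_prod_altWord {M : Type*} [Monoid M] (f : I → M) (n : ℕ) : ∀ i j : I,
    ((altWord i j n).map f).prod = altProd (f i) (f j) n := by
  induction n with
  | zero => intro i j; rfl
  | succ n ih => intro i j; simp [altWord, altProd, ih]

theorem length_altWord (n : ℕ) : ∀ i j : I, (altWord i j n).length = n := by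
  induction n with
  | zero => intro i j; rfl
  | succ n ih => intro i j; simp [altWord, ih]

theorem wordProd_altWord (i j : I) (n : ℕ) :
    Φ.wordProd (altWord i j n) = altProd (Φ.s i) (Φ.s j) n :=
  map_prod_altWord Φ.s n i j

/-- A word is reduced if no shorter word has the same product. -/
def IsReducedWord (L : List I) : Prop := Φ.length (Φ.wordProd L) = L.length

theorem IsReducedWord.append_right {L L' : List I} (h : Φ.IsReducedWord (L ++ L')) :
    Φ.IsReducedWord L' := by
  unfold IsReducedWord at h ⊢
  rw [wordProd_append, List.length_append] at h
  have h1 := Φ.length_mul_le (Φ.wordProd L) (Φ.wordProd L')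
  have h2 := Φ.length_wordProd_le L
  have h3 := Φ.length_wordProd_le L'
  omega

/-- Lengthen the alternating prefix one letter at a time: exchange with `s_i` in a reduced word
starting `j i j ⋯`. The deleted letter lies behind the prefix, since alternating words of length at
most `m_{ij}` are reduced. -/
theorem exists_altWord_append {i j : I} (hij : i ≠ j) {w : Φ.Weyl}
    (hi : Φ.length (Φ.s i * w) < Φ.length w) (hj : Φ.length (Φ.s j * w) < Φ.length w) (n : ℕ)
    (hn : orderOf (Φ.s i * Φ.s j) = 0 ∨ n ≤ orderOf (Φ.s i * Φ.s j)) :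
    ∃ X, Φ.wordProd (altWord i j n ++ X) = w ∧ (altWord i j n ++ X).length = Φ.length w := by
  induction n generalizing i j with
  | zero => exact Φ.exists_word w
  | succ n ih =>
    obtain ⟨X, hX, hXl⟩ := ih hij.symm hj hi (by rw [orderOf_s_mul_comm]; omega)
    obtain ⟨L₁, c, L₂, h, h'⟩ := Φ.exchange_left (altWord j i n ++ X) i (by rw [hX]; exact hi.le)
    rw [hX] at h'
    have hw : w = Φ.s i * Φ.wordProd (L₁ ++ L₂) := by rw [← h', s_mul_s_assoc]
    have hl := congrArg List.length h
    rcases List.append_eq_append_iff.mp h with ⟨Y, hY, hY'⟩ | ⟨Y, hY, hY'⟩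
    · refine ⟨Y ++ L₂, ?_, ?_⟩
      · rw [hw, hY, altWord, List.cons_append, wordProd_cons, List.append_assoc]
      · rw [hY'] at hXl
        simp only [altWord, List.length_append, List.length_cons] at hXl ⊢
        simp only [length_altWord] at hXl ⊢
        omega
    · rcases Y with _ | ⟨d, Y⟩
      · simp only [List.append_nil, List.nil_append] at hY hY'
        refine ⟨L₂, ?_, ?_⟩
        · rw [hw, ← hY, altWord, List.cons_append, wordProd_cons]
        · rw [← hY'] at hXl
          simp only [altWord, List.length_append, List.length_cons, length_altWord] at hXl ⊢
          omega
      -- A letter deleted within the prefix would express `s_i` times the prefix, of length `n + 1`,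
      -- by `n - 1` letters.
      · exfalso
        simp only [List.cons_append, List.cons.injEq] at hY'
        obtain ⟨rfl, rfl⟩ := hY'
        have h1 : Φ.s i * altProd (Φ.s j) (Φ.s i) n = Φ.wordProd (L₁ ++ Y) := by
          have : Φ.s i * (altProd (Φ.s j) (Φ.s i) n * Φ.wordProd X) =
              Φ.wordProd (L₁ ++ Y) * Φ.wordProd X := by
            rw [← wordProd_altWord, ← wordProd_append, hX, h', ← wordProd_append,
              List.append_assoc]
          rw [← mul_assoc] at this
          exact mul_right_cancel this
        have h2 := Φ.length_altProd hij hn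
        have h3 := Φ.length_wordProd_le (L₁ ++ Y)
        have h4 := congrArg List.length hY
        rw [altProd, h1] at h2
        simp only [length_altWord, List.length_append, List.length_cons] at h3 h4
        omega

/-- **Matsumoto's theorem**: a map to a monoid satisfying the braid relations takes the same value
on all reduced words of a Weyl group element. -/
theorem map_prod_eq_of_isReducedWord {M : Type*} [Monoid M] (f : I → M)
    (hf : ∀ i j, altProd (f i) (f j) (orderOf (Φ.s i * Φ.s j)) =
      altProd (f j) (f i) (orderOf (Φ.s i * Φ.s j))) (n : ℕ) :
    ∀ L L' : List I, L.length = n → Φ.IsReducedWord L → Φ.IsReducedWord L' →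
      Φ.wordProd L = Φ.wordProd L' → (L.map f).prod = (L'.map f).prod := by
  induction n using Nat.strong_induction_on with
  | _ n ih =>
  have same : ∀ (P L L' : List I), P ≠ [] → (P ++ L).length = n → Φ.IsReducedWord (P ++ L) →
      Φ.IsReducedWord (P ++ L') → Φ.wordProd (P ++ L) = Φ.wordProd (P ++ L') →
      (L.map f).prod = (L'.map f).prod := by
    intro P L L' hP hl h h' hw
    have := List.length_pos_iff.mpr hP
    rw [List.length_append] at hl
    refine ih L.length (by omega) L L' rfl h.append_right h'.append_right ?_
    rw [wordProd_append, wordProd_append] at hw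
    exact mul_left_cancel hw
  intro L L' hL h h' hw
  have hL' : L'.length = n := by rw [← h', ← hw, h, hL]
  rcases L with _ | ⟨i, L⟩
  · rw [List.length_nil] at hL
    rw [← hL, List.length_eq_zero_iff] at hL'
    rw [hL']
  rcases L' with _ | ⟨j, L'⟩
  · rw [List.length_nil] at hL'; rw [← hL'] at hL; simp at hL
  by_cases hij : i = j
  · subst hij
    rw [List.map_cons, List.map_cons, List.prod_cons, List.prod_cons,
      same [i] L L' (by simp) hL h h' hw]
  have desc : ∀ k K, Φ.IsReducedWord (k :: K) →
      Φ.length (Φ.s k * Φ.wordProd (k :: K)) < Φ.length (Φ.wordProd (k :: K)) := by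
    intro k K hK
    rw [hK, wordProd_cons, s_mul_s_assoc, List.length_cons]
    exact Nat.lt_succ_of_le (Φ.length_wordProd_le K)
  have hi := desc i L h
  have hj := desc j L' h'
  rw [← hw] at hj
  have hwn : Φ.length (Φ.wordProd (i :: L)) = n := by rw [h, hL]
  set w := Φ.wordProd (i :: L)
  set m := orderOf (Φ.s i * Φ.s j) with hm
  -- For infinite order, arbitrarily long alternating prefixes would fit into a reduced word of `w`.
  by_cases hm0 : m = 0
  · exfalso
    obtain ⟨X, -, hX⟩ := Φ.exists_altWord_append hij hi hj (n + 1) (Or.inl hm0)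
    rw [List.length_append, length_altWord] at hX
    omega
  -- Pass from `iL` to `(i j ⋯)X`, then to `(j i ⋯)Y`, then to `jL'`. The outer steps share a first
  -- letter and follow by induction; the middle one is the braid relation, together with induction
  -- for `X` and `Y`.
  obtain ⟨X, hX, hXl⟩ := Φ.exists_altWord_append hij hi hj m (Or.inr le_rfl)
  obtain ⟨Y, hY, hYl⟩ := Φ.exists_altWord_append (Ne.symm hij) hj hi m
    (Or.inr (by rw [orderOf_s_mul_comm]))
  have hXr : Φ.IsReducedWord (altWord i j m ++ X) := by rw [IsReducedWord, hX, hXl]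
  have hYr : Φ.IsReducedWord (altWord j i m ++ Y) := by rw [IsReducedWord, hY, hYl]
  have e1 : ((i :: L).map f).prod = ((altWord i j m ++ X).map f).prod := by
    obtain ⟨m', hm'⟩ := Nat.exists_eq_succ_of_ne_zero hm0
    rw [hm'] at hXr hX ⊢
    have := same [i] L (altWord j i m' ++ X) (by simp) hL h hXr hX.symm
    simp only [altWord, List.cons_append, List.map_cons, List.prod_cons, this]
  have e2 : ((j :: L').map f).prod = ((altWord j i m ++ Y).map f).prod := by
    obtain ⟨m', hm'⟩ := Nat.exists_eq_succ_of_ne_zero hm0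
    rw [hm'] at hYr hY ⊢
    have := same [j] L' (altWord i j m' ++ Y) (by simp) hL' h' hYr (hw.symm.trans hY.symm)
    simp only [altWord, List.cons_append, List.map_cons, List.prod_cons, this]
  have e3 : (X.map f).prod = (Y.map f).prod := by
    rw [List.length_append, length_altWord] at hXl
    refine ih X.length (by omega) X Y rfl hXr.append_right hYr.append_right ?_
    have := hX.trans hY.symm
    rw [wordProd_append, wordProd_append, wordProd_altWord, wordProd_altWord, hm, s_braid] at this
    exact mul_left_cancel this
  rw [e1, e2, List.map_append, List.map_append, List.prod_append, List.prod_append, e3,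
    map_prod_altWord, map_prod_altWord, hm, hf]

/-! ### Products of the generators of the Hecke algebra -/

/-- The parameter `v - v⁻¹`. -/
def heckeParam : ℤ[T;T⁻¹] := LaurentPolynomial.T 1 - LaurentPolynomial.T (-1)

theorem heckeT_wordProd {L : List I} (h : Φ.IsReducedWord L) :
    Φ.heckeT (Φ.wordProd L) = (L.map Φ.heckeGen).prod := by
  have hc := (Φ.exists_reduced (Φ.wordProd L)).choose_spec
  rw [heckeT, ← Function.comp_def, ← List.map_ofFn]
  rw [← wordProd_ofFn] at hc
  refine Φ.map_prod_eq_of_isReducedWord Φ.heckeGen Φ.heckeGen_braid _ _ _ rfl ?_ h hc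
  rw [IsReducedWord, hc, List.length_ofFn]

theorem heckeT_one : Φ.heckeT 1 = 1 := by
  have := Φ.heckeT_wordProd (L := []) (by simp [IsReducedWord])
  simpa using this

theorem heckeT_mul_s {w : Φ.Weyl} {i : I} (h : Φ.length w < Φ.length (w * Φ.s i)) :
    Φ.heckeT (w * Φ.s i) = Φ.heckeT w * Φ.heckeGen i := by
  obtain ⟨L, rfl, hL⟩ := Φ.exists_word w
  have h1 : Φ.wordProd (L ++ [i]) = Φ.wordProd L * Φ.s i := by simp
  rw [← h1, heckeT_wordProd, heckeT_wordProd]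
  · simp
  · exact hL.symm
  · have := Φ.length_mul_s_le i (Φ.wordProd L)
    rw [IsReducedWord, h1, List.length_append, List.length_singleton]
    omega

/-! ### The regular representation -/

open Classical in
/-- Left multiplication by `T_i` in the basis `T_w`. -/
def leftOp (i : I) : Module.End ℤ[T;T⁻¹] (Φ.Weyl →₀ ℤ[T;T⁻¹]) :=
  Finsupp.linearCombination ℤ[T;T⁻¹] fun w => Finsupp.single (Φ.s i * w) 1 +
    (if Φ.length w < Φ.length (Φ.s i * w) then 0 else heckeParam) • Finsupp.single w 1

open Classical in
/-- Right multiplication by `T_i` in the basis `T_w`. -/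
def rightOp (i : I) : Module.End ℤ[T;T⁻¹] (Φ.Weyl →₀ ℤ[T;T⁻¹]) :=
  Finsupp.linearCombination ℤ[T;T⁻¹] fun w => Finsupp.single (w * Φ.s i) 1 +
    (if Φ.length w < Φ.length (w * Φ.s i) then 0 else heckeParam) • Finsupp.single w 1

theorem leftOp_single (i : I) (w : Φ.Weyl) :
    Φ.leftOp i (Finsupp.single w 1) = Finsupp.single (Φ.s i * w) 1 +
      (if Φ.length w < Φ.length (Φ.s i * w) then 0 else heckeParam) • Finsupp.single w 1 := by
  rw [leftOp, Finsupp.linearCombination_single, one_smul]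

theorem rightOp_single (i : I) (w : Φ.Weyl) :
    Φ.rightOp i (Finsupp.single w 1) = Finsupp.single (w * Φ.s i) 1 +
      (if Φ.length w < Φ.length (w * Φ.s i) then 0 else heckeParam) • Finsupp.single w 1 := by
  rw [rightOp, Finsupp.linearCombination_single, one_smul]

theorem end_ext {f g : Module.End ℤ[T;T⁻¹] (Φ.Weyl →₀ ℤ[T;T⁻¹])}
    (h : ∀ w, f (Finsupp.single w 1) = g (Finsupp.single w 1)) : f = g :=
  Finsupp.lhom_ext' fun w => LinearMap.ext_ring (h w)

/-- If `s_i w = w s_j`, the two results agree term by term. Otherwise multiplication on one side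
does not affect descents on the other, so the same parameters occur in both. -/
theorem leftOp_commute_rightOp (i j : I) : Commute (Φ.leftOp i) (Φ.rightOp j) := by
  refine Φ.end_ext fun w => ?_
  rw [Module.End.mul_apply, Module.End.mul_apply, leftOp_single, rightOp_single, map_add, map_add,
    map_smul, map_smul, leftOp_single, leftOp_single, rightOp_single, rightOp_single, ← mul_assoc]
  by_cases h : Φ.s i * w = w * Φ.s j
  · have h3 : Φ.s i * w * Φ.s j = w := by rw [h, mul_s_mul_s]
    rw [h3, h]
  · have h1 := Φ.length_lt_mul_s_iff i j w h
    have h2 := Φ.length_lt_s_mul_iff i j w h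
    simp only [h1, h2]
    module

theorem leftOp_sq (i : I) : Φ.leftOp i * Φ.leftOp i = 1 + heckeParam • Φ.leftOp i := by
  refine Φ.end_ext fun w => ?_
  rw [Module.End.mul_apply, LinearMap.add_apply, LinearMap.smul_apply, Module.End.one_apply,
    leftOp_single, map_add, map_smul, leftOp_single, leftOp_single, s_mul_s_assoc]
  have h1 := Φ.length_s_mul_lt_iff i w
  by_cases hlt : Φ.length w < Φ.length (Φ.s i * w)
  · have := not_lt.mpr hlt.le
    simp only [hlt, this, if_true, if_false]
    module
  · have := h1.mpr hlt
    simp only [hlt, this, if_true, if_false]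
    module

/-- Right multiplications compose in the opposite order, hence the reversal; reducedness excludes
the parameter terms. -/
theorem rightOp_list_single (L : List I) (h : Φ.IsReducedWord L) :
    (L.reverse.map Φ.rightOp).prod (Finsupp.single 1 1) = Finsupp.single (Φ.wordProd L) 1 := by
  induction L using List.reverseRecOn with
  | nil => simp
  | append_singleton L i ih =>
    have h1 := Φ.length_wordProd_le L
    have h2 := Φ.length_mul_s_le i (Φ.wordProd L)
    have h' : Φ.IsReducedWord L := by
      rw [IsReducedWord] at h ⊢
      simp only [wordProd_append, wordProd_cons, wordProd_nil, mul_one, List.length_append,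
        List.length_singleton] at h
      omega
    rw [IsReducedWord, wordProd_append, wordProd_cons, wordProd_nil, mul_one, List.length_append,
      List.length_singleton, ← h'] at h
    rw [List.reverse_append, List.reverse_singleton, List.singleton_append, List.map_cons,
      List.prod_cons, Module.End.mul_apply, ih h', rightOp_single, if_pos (by omega)]
    simp

/-- An endomorphism commuting with the right multiplications is determined by its value at the
unit element. -/
theorem eq_of_commute_rightOp {f g : Module.End ℤ[T;T⁻¹] (Φ.Weyl →₀ ℤ[T;T⁻¹])}
    (hf : ∀ i, Commute f (Φ.rightOp i)) (hg : ∀ i, Commute g (Φ.rightOp i))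
    (h : f (Finsupp.single 1 1) = g (Finsupp.single 1 1)) : f = g := by
  refine Φ.end_ext fun w => ?_
  obtain ⟨L, rfl, hL⟩ := Φ.exists_word w
  rw [← Φ.rightOp_list_single L hL.symm, ← Module.End.mul_apply, ← Module.End.mul_apply,
    (Commute.list_prod_right _ _ fun x hx => ?_).eq, (Commute.list_prod_right _ g fun x hx => ?_).eq,
    Module.End.mul_apply, Module.End.mul_apply, h]
  · obtain ⟨i, -, rfl⟩ := List.mem_map.mp hx; exact hg i
  · obtain ⟨i, -, rfl⟩ := List.mem_map.mp hx; exact hf i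

theorem commute_altProd {M : Type*} [Monoid M] {c : M} (n : ℕ) : ∀ {a b : M}, Commute a c →
    Commute b c → Commute (altProd a b n) c := by
  induction n with
  | zero => intro a b _ _; exact Commute.one_left c
  | succ n ih => intro a b ha hb; exact ha.mul_left (ih hb ha)

theorem leftOp_altProd_single {i j : I} (hij : i ≠ j) {n : ℕ}
    (hn : orderOf (Φ.s i * Φ.s j) = 0 ∨ n ≤ orderOf (Φ.s i * Φ.s j)) :
    altProd (Φ.leftOp i) (Φ.leftOp j) n (Finsupp.single 1 1) =
      Finsupp.single (altProd (Φ.s i) (Φ.s j) n) 1 := by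
  induction n generalizing i j with
  | zero => rfl
  | succ n ih =>
    have h1 := Φ.length_altProd hij hn
    have h2 := Φ.length_altProd_le n j i
    rw [altProd] at h1 ⊢
    rw [Module.End.mul_apply, ih hij.symm (by rw [orderOf_s_mul_comm]; omega), leftOp_single,
      if_pos (by omega), zero_smul, add_zero, altProd]

/-- Both sides commute with all right operators, so only the value at the unit matters. There the
alternating words stay reduced and the claim is the braid relation in `W`. -/
theorem leftOp_braid (i j : I) :
    altProd (Φ.leftOp i) (Φ.leftOp j) (orderOf (Φ.s i * Φ.s j)) =
      altProd (Φ.leftOp j) (Φ.leftOp i) (orderOf (Φ.s i * Φ.s j)) := by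
  by_cases hij : i = j
  · rw [hij]
  refine Φ.eq_of_commute_rightOp
    (fun k => commute_altProd _ (Φ.leftOp_commute_rightOp i k) (Φ.leftOp_commute_rightOp j k))
    (fun k => commute_altProd _ (Φ.leftOp_commute_rightOp j k) (Φ.leftOp_commute_rightOp i k)) ?_
  rw [Φ.leftOp_altProd_single hij (Or.inr le_rfl), Φ.leftOp_altProd_single (Ne.symm hij)
    (Or.inr (by rw [orderOf_s_mul_comm])), s_braid]

theorem quadratic_of_sq_eq {B : Type*} [Ring B] [Algebra ℤ[T;T⁻¹] B] {x : B}
    (hx : x * x = 1 + heckeParam • x) : (x - algebraMap ℤ[T;T⁻¹] B (LaurentPolynomial.T 1)) *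
      (x + algebraMap ℤ[T;T⁻¹] B (LaurentPolynomial.T (-1))) = 0 := by
  have h : (LaurentPolynomial.T 1 : ℤ[T;T⁻¹]) * LaurentPolynomial.T (-1) = 1 := by
    rw [← LaurentPolynomial.T_add, add_neg_cancel, LaurentPolynomial.T_zero]
  rw [sub_mul, mul_add, mul_add, hx, ← Algebra.commutes, ← map_mul, h, map_one,
    ← Algebra.smul_def, ← Algebra.smul_def, heckeParam]
  module

/-- The left regular representation of the Hecke algebra. -/
def regularRep : Φ.Hecke →ₐ[ℤ[T;T⁻¹]] Module.End ℤ[T;T⁻¹] (Φ.Weyl →₀ ℤ[T;T⁻¹]) :=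
  Φ.heckeLift (FreeAlgebra.lift ℤ[T;T⁻¹] Φ.leftOp) (by
    intro x y h
    induction h with
    | braid i j =>
      rw [map_altProd, map_altProd, FreeAlgebra.lift_ι_apply, FreeAlgebra.lift_ι_apply,
        leftOp_braid]
    | quadratic i =>
      rw [map_mul, map_sub, map_add, map_zero, FreeAlgebra.lift_ι_apply, AlgHom.commutes,
        AlgHom.commutes]
      exact quadratic_of_sq_eq (B := Module.End ℤ[T;T⁻¹] (Φ.Weyl →₀ ℤ[T;T⁻¹])) (Φ.leftOp_sq i))

theorem regularRep_heckeGen (i : I) : Φ.regularRep (Φ.heckeGen i) = Φ.leftOp i :=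
  (Φ.heckeLift_heckeMk _ _ _).trans (FreeAlgebra.lift_ι_apply _ _)

theorem leftOp_list_single (L : List I) (h : Φ.IsReducedWord L) :
    (L.map Φ.leftOp).prod (Finsupp.single 1 1) = Finsupp.single (Φ.wordProd L) 1 := by
  induction L with
  | nil => simp
  | cons i L ih =>
    have h' : Φ.IsReducedWord L := IsReducedWord.append_right (L := [i]) Φ h
    rw [IsReducedWord, wordProd_cons, List.length_cons, ← h'] at h
    rw [List.map_cons, List.prod_cons, Module.End.mul_apply, ih h', leftOp_single,
      if_pos (by omega)]
    simp

/-! ### Linear independence of the elements `T_w` and of their conjugates -/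

theorem regularRep_heckeT (w : Φ.Weyl) :
    Φ.regularRep (Φ.heckeT w) (Finsupp.single 1 1) = Finsupp.single w 1 := by
  obtain ⟨L, rfl, hL⟩ := Φ.exists_word w
  rw [Φ.heckeT_wordProd hL.symm, map_list_prod, List.map_map,
    show (Φ.regularRep : Φ.Hecke → _) ∘ Φ.heckeGen = Φ.leftOp from
      funext Φ.regularRep_heckeGen, Φ.leftOp_list_single L hL.symm]

theorem linearIndependent_heckeT : LinearIndependent ℤ[T;T⁻¹] Φ.heckeT := by
  let f : Φ.Hecke →ₗ[ℤ[T;T⁻¹]] (Φ.Weyl →₀ ℤ[T;T⁻¹]) :=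
    (LinearMap.applyₗ (Finsupp.single (1 : Φ.Weyl) (1 : ℤ[T;T⁻¹]))) ∘ₗ Φ.regularRep.toLinearMap
  refine LinearIndependent.of_comp f ?_
  have : f ∘ Φ.heckeT = fun w => Finsupp.single w 1 := funext Φ.regularRep_heckeT
  rw [this]
  exact Finsupp.linearIndependent_single_one _ _

theorem bar_smul (c : ℤ[T;T⁻¹]) (x : Φ.Hecke) :
    Φ.bar (c • x) = LaurentPolynomial.invert c • Φ.bar x := by
  rw [Algebra.smul_def, map_mul, bar_algebraMap, ← Algebra.smul_def]

/-- The involution is semilinear, so it turns a relation among the `bar T_w` into one among the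
`T_w`. -/
theorem linearIndependent_bar_heckeT :
    LinearIndependent ℤ[T;T⁻¹] fun w => Φ.bar (Φ.heckeT w) := by
  rw [linearIndependent_iff']
  intro s g hg i hi
  have h := congrArg Φ.bar hg
  rw [map_sum, map_zero] at h
  simp only [bar_smul, bar_bar] at h
  have := linearIndependent_iff'.mp Φ.linearIndependent_heckeT s _ h i hi
  simpa using this

/-! ### Right multiplication by a generator -/

theorem heckeGen_eq (i : I) :
    Φ.heckeGen i = ↑(Φ.heckeUnit i)⁻¹ + algebraMap ℤ[T;T⁻¹] Φ.Hecke heckeParam := by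
  change _ = Φ.heckeGen i - _ + _
  rw [heckeParam, map_sub]
  abel

theorem bar_heckeT_mul_heckeGen_of_lt {w : Φ.Weyl} {i : I}
    (h : Φ.length w < Φ.length (w * Φ.s i)) :
    Φ.bar (Φ.heckeT w) * Φ.heckeGen i =
      Φ.bar (Φ.heckeT (w * Φ.s i)) + heckeParam • Φ.bar (Φ.heckeT w) := by
  rw [Φ.heckeT_mul_s h, map_mul, bar_heckeGen]
  nth_rewrite 1 [heckeGen_eq]
  rw [mul_add, ← Algebra.commutes, ← Algebra.smul_def]

theorem bar_heckeT_mul_heckeGen_of_not_lt {w : Φ.Weyl} {i : I}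
    (h : ¬ Φ.length w < Φ.length (w * Φ.s i)) :
    Φ.bar (Φ.heckeT w) * Φ.heckeGen i = Φ.bar (Φ.heckeT (w * Φ.s i)) := by
  have h1 := Φ.heckeT_mul_s (w := w * Φ.s i) (i := i) (by
    rw [mul_s_mul_s]; exact (Φ.length_mul_s_lt_iff i w).mpr h)
  rw [mul_s_mul_s] at h1
  rw [h1, map_mul, bar_heckeGen, mul_assoc]
  have : (↑(Φ.heckeUnit i)⁻¹ : Φ.Hecke) * Φ.heckeGen i = 1 := (Φ.heckeUnit i).inv_mul
  rw [this, mul_one]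

/-! ### Subexpressions of an expression and of its initial segment -/

theorem sum_finset_fin_succ {M : Type*} [AddCommMonoid M] {r : ℕ}
    (f : Finset (Fin (r + 1)) → M) :
    ∑ τ, f τ = ∑ τ : Finset (Fin r),
      (f (τ.map Fin.castSuccEmb) + f (insert (Fin.last r) (τ.map Fin.castSuccEmb))) := by
  have h : (Finset.univ : Finset (Fin (r + 1))) =
      insert (Fin.last r) (Finset.univ.map Fin.castSuccEmb) := by
    ext k
    induction k using Fin.lastCases <;> simp
  have h' : (Finset.univ.map Fin.castSuccEmb : Finset (Fin (r + 1))).powerset =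
      Finset.univ.map (Finset.mapEmbedding Fin.castSuccEmb).toEmbedding := by
    ext τ
    simp [Finset.subset_map_iff, eq_comm]
  rw [← Finset.powerset_univ, h, Finset.sum_powerset_insert (by simp), ← Finset.sum_add_distrib,
    h', Finset.sum_map]
  rfl

/-- Describing `τ'` only by its restriction to the initial segment covers both extensions, with and
without the last letter. -/
theorem init_entry {r : ℕ} (σ : Fin (r + 1) → I) {τ : Finset (Fin r)} {τ' : Finset (Fin (r + 1))}
    (h : ∀ k : Fin r, k.castSucc ∈ τ' ↔ k ∈ τ) :
    Fin.init (Φ.entry σ τ') = Φ.entry (Fin.init σ) τ := by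
  classical
  funext k
  simp only [entry, Fin.init, h]

theorem subProd_succ {r : ℕ} (σ : Fin (r + 1) → I) {τ : Finset (Fin r)} {τ' : Finset (Fin (r + 1))}
    (h : ∀ k : Fin r, k.castSucc ∈ τ' ↔ k ∈ τ) :
    Φ.subProd σ τ' = Φ.subProd (Fin.init σ) τ * Φ.entry σ τ' (Fin.last r) := by
  rw [subProd, List.ofFn_succ', List.concat_eq_append, List.prod_append, List.prod_singleton,
    subProd, ← Φ.init_entry σ h]
  rfl

theorem wallRoot_castSucc {r : ℕ} (σ : Fin (r + 1) → I) {τ : Finset (Fin r)} {τ' : Finset (Fin (r + 1))}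
    (h : ∀ k : Fin r, k.castSucc ∈ τ' ↔ k ∈ τ) (k : Fin r) :
    Φ.wallRoot σ τ' k.castSucc = Φ.wallRoot (Fin.init σ) τ k := by
  rw [wallRoot, wallRoot, ← Φ.init_entry σ h, Fin.partialProd_init, Fin.succ_castSucc]
  rfl

theorem wallRoot_last {r : ℕ} (σ : Fin (r + 1) → I) (τ : Finset (Fin (r + 1))) :
    Φ.wallRoot σ τ (Fin.last r) = -(Φ.subProd σ τ • Φ.root (σ (Fin.last r))) := by
  rw [wallRoot, coe_apply, Fin.succ_last, Fin.partialProd, subProd, List.take_of_length_le (by simp)]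

theorem subProd_univ {r : ℕ} (σ : Fin r → I) : Φ.subProd σ Finset.univ = Φ.prod σ := by
  have : Φ.entry σ Finset.univ = fun k => Φ.s (σ k) := by
    funext k
    rw [entry, if_pos (Finset.mem_univ k)]
  rw [subProd, prod, this]

theorem prod_succ {r : ℕ} (σ : Fin (r + 1) → I) :
    Φ.prod σ = Φ.prod (Fin.init σ) * Φ.s (σ (Fin.last r)) := by
  rw [← subProd_univ, ← subProd_univ, Φ.subProd_succ σ (τ := Finset.univ) (by simp)]
  simp [entry]

theorem length_prod_le {r : ℕ} (σ : Fin r → I) : Φ.length (Φ.prod σ) ≤ r := by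
  rw [← wordProd_ofFn]
  simpa using Φ.length_wordProd_le (List.ofFn σ)

theorem IsReduced.init {r : ℕ} {σ : Fin (r + 1) → I} (h : Φ.IsReduced σ) :
    Φ.IsReduced (Fin.init σ) := by
  rw [IsReduced, prod_succ] at h
  have h1 := Φ.length_mul_s_le (σ (Fin.last r)) (Φ.prod (Fin.init σ))
  have h2 := Φ.length_prod_le (Fin.init σ)
  rw [IsReduced]
  omega

/-! ### Distinguishedness as an ascent condition -/

theorem smul_root_mem_posRoots_iff {w : Φ.Weyl} {i : I} :
    w • Φ.root i ∈ Φ.posRoots ↔ Φ.length w < Φ.length (w * Φ.s i) := by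
  rw [mem_posRoots_iff, smul_root_mem_rootCone_iff, and_iff_right (Φ.smul_root_mem_roots w i)]

/-- The full expression always contributes the sign `+`, as `σ` is reduced. If the last letter is
skipped, the sign for `-A_0` is `+` exactly when the product so far sends the simple root to a
positive root, that is, at an ascent. -/
theorem isDistinguished_succ_iff {r : ℕ} {σ : Fin (r + 1) → I} (hσ : Φ.IsReduced σ)
    {τ : Finset (Fin r)} {τ' : Finset (Fin (r + 1))} (h : ∀ k : Fin r, k.castSucc ∈ τ' ↔ k ∈ τ) :
    Φ.IsDistinguished Φ.posRoots (-Φ.posRoots) σ Finset.univ τ' ↔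
      Φ.IsDistinguished Φ.posRoots (-Φ.posRoots) (Fin.init σ) Finset.univ τ ∧
      (Fin.last r ∉ τ' → Φ.length (Φ.subProd (Fin.init σ) τ) <
        Φ.length (Φ.subProd (Fin.init σ) τ * Φ.s (σ (Fin.last r)))) := by
  have hpos : Φ.wallRoot σ Finset.univ (Fin.last r) ∈ Φ.posRoots := by
    rw [wallRoot_last, subProd_univ, prod_succ, mul_smul, s_smul_root_self, smul_neg, neg_neg,
      smul_root_mem_posRoots_iff]
    have h1 := Φ.length_prod_le (Fin.init σ)
    have h2 : Φ.length (Φ.prod σ) = r + 1 := hσ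
    rw [prod_succ] at h2
    omega
  have hlast : Fin.last r ∉ τ' → (sgn Φ.posRoots (Φ.wallRoot σ Finset.univ (Fin.last r)) =
      sgn (-Φ.posRoots) (Φ.wallRoot σ τ' (Fin.last r)) ↔
      Φ.length (Φ.subProd (Fin.init σ) τ) <
        Φ.length (Φ.subProd (Fin.init σ) τ * Φ.s (σ (Fin.last r)))) := by
    intro hl
    have he : Φ.subProd σ τ' = Φ.subProd (Fin.init σ) τ := by
      rw [Φ.subProd_succ σ h]; simp [entry, hl]
    rw [sgn, if_pos hpos, sgn, wallRoot_last, Set.neg_mem_neg, he, smul_root_mem_posRoots_iff]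
    split_ifs with hlt <;> simp [hlt]
  simp only [IsDistinguished, Finset.subset_univ, true_and, Finset.mem_univ, true_implies,
    Fin.forall_fin_succ', h, Φ.wallRoot_castSucc σ h,
    Φ.wallRoot_castSucc σ (τ := Finset.univ) (τ' := Finset.univ) (by simp)]
  exact and_congr_right fun _ => forall_congr' hlast

theorem heckeT_prod {r : ℕ} {σ : Fin (r + 1) → I} (hσ : Φ.IsReduced σ) :
    Φ.heckeT (Φ.prod σ) =
      Φ.heckeT (Φ.prod (Fin.init σ)) * Φ.heckeGen (σ (Fin.last r)) := by
  rw [prod_succ, heckeT_mul_s]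
  have h1 := Φ.length_prod_le (Fin.init σ)
  have h2 : Φ.length (Φ.prod σ) = r + 1 := hσ
  rw [prod_succ] at h2
  omega

theorem kappa_map_castSucc {r : ℕ} (τ : Finset (Fin r)) :
    kappa (τ.map Fin.castSuccEmb) = kappa τ + 1 := by
  have := τ.card_le_univ
  rw [Fintype.card_fin] at this
  rw [kappa, kappa, Finset.card_compl, Finset.card_compl, Finset.card_map, Fintype.card_fin,
    Fintype.card_fin]
  omega

theorem kappa_insert_map_castSucc {r : ℕ} (τ : Finset (Fin r)) :
    kappa (insert (Fin.last r) (τ.map Fin.castSuccEmb)) = kappa τ := by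
  rw [kappa, kappa, Finset.card_compl, Finset.card_compl, Finset.card_insert_of_notMem (by simp),
    Finset.card_map, Fintype.card_fin, Fintype.card_fin]
  omega

open Classical in
/-- The expansion of `T_w` in the elements `\bar T_u` that is given by the distinguished
subexpressions of a reduced expression of `w`. -/
theorem heckeT_eq_sum_isDistinguished {r : ℕ} (σ : Fin r → I) (hσ : Φ.IsReduced σ) :
    Φ.heckeT (Φ.prod σ) = ∑ τ : Finset (Fin r),
      if Φ.IsDistinguished Φ.posRoots (-Φ.posRoots) σ Finset.univ τ then
        heckeParam ^ kappa τ • Φ.bar (Φ.heckeT (Φ.subProd σ τ)) else 0 := by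
  induction r with
  | zero =>
    rw [Fintype.sum_unique, if_pos ⟨Finset.subset_univ _, fun k => k.elim0⟩]
    have h : kappa (default : Finset (Fin 0)) = 0 := by simp [kappa, Finset.eq_empty_of_isEmpty]
    rw [h, pow_zero, one_smul]
    simp [prod, subProd, heckeT_one]
  | succ r ih =>
    rw [Φ.heckeT_prod hσ, ih _ (IsReduced.init Φ hσ), sum_finset_fin_succ, Finset.sum_mul]
    refine Finset.sum_congr rfl fun τ _ => ?_
    have h1 : ∀ k : Fin r, k.castSucc ∈ τ.map Fin.castSuccEmb ↔ k ∈ τ := by simp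
    have h2 : ∀ k : Fin r, k.castSucc ∈ insert (Fin.last r) (τ.map Fin.castSuccEmb) ↔ k ∈ τ := by
      simp [Fin.castSucc_ne_last]
    rw [Φ.isDistinguished_succ_iff hσ h1, Φ.isDistinguished_succ_iff hσ h2,
      Φ.subProd_succ σ h1, Φ.subProd_succ σ h2, kappa_map_castSucc, kappa_insert_map_castSucc]
    have h3 : Φ.entry σ (τ.map Fin.castSuccEmb) (Fin.last r) = 1 := by simp [entry]
    have h4 : Φ.entry σ (insert (Fin.last r) (τ.map Fin.castSuccEmb)) (Fin.last r) =
        Φ.s (σ (Fin.last r)) := by simp [entry]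
    rw [h3, h4, mul_one]
    by_cases hD : Φ.IsDistinguished Φ.posRoots (-Φ.posRoots) (Fin.init σ) Finset.univ τ
    · rw [if_pos hD, if_pos (c := _ ∧ (Fin.last r ∉ insert _ _ → _)) ⟨hD, by simp⟩, smul_mul_assoc]
      -- At an ascent both extensions of `τ` are distinguished and match the two terms of the
      -- product; otherwise only the one taking the letter survives.
      by_cases hlt : Φ.length (Φ.subProd (Fin.init σ) τ) <
          Φ.length (Φ.subProd (Fin.init σ) τ * Φ.s (σ (Fin.last r)))
      · rw [if_pos ⟨hD, fun _ => hlt⟩, Φ.bar_heckeT_mul_heckeGen_of_lt hlt, smul_add, smul_smul,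
          ← pow_succ, add_comm]
      · rw [if_neg fun hh => hlt (hh.2 (by simp)), Φ.bar_heckeT_mul_heckeGen_of_not_lt hlt,
          zero_add]
    · simp [hD]

/-! ### The `R`-polynomials -/

theorem T_sub_mul_T_sub (a b : ℤ) :
    (LaurentPolynomial.T (a - b) : ℤ[T;T⁻¹]) * LaurentPolynomial.T (b - a) = 1 := by
  rw [← LaurentPolynomial.T_add, sub_add_sub_cancel, sub_self, LaurentPolynomial.T_zero]

open Classical in
/-- The coefficients of `T_w`, `w = π(σ)`, with respect to the elements `\bar T_u`. -/
def deodharSum {r : ℕ} (σ : Fin r → I) : Φ.Weyl →₀ ℤ[T;T⁻¹] :=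
  ∑ τ : Finset (Fin r) with Φ.IsDistinguished Φ.posRoots (-Φ.posRoots) σ Finset.univ τ,
    Finsupp.single (Φ.subProd σ τ) (heckeParam ^ kappa τ)

theorem linearCombination_deodharSum {r : ℕ} (σ : Fin r → I) (hσ : Φ.IsReduced σ) :
    Finsupp.linearCombination ℤ[T;T⁻¹] (fun u => Φ.bar (Φ.heckeT u)) (Φ.deodharSum σ) =
      Φ.heckeT (Φ.prod σ) := by
  classical
  rw [Φ.heckeT_eq_sum_isDistinguished σ hσ, deodharSum, map_sum, Finset.sum_filter]
  simp only [Finsupp.linearCombination_single]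

open Classical in
theorem deodharSum_apply {r : ℕ} (σ : Fin r → I) (u : Φ.Weyl) :
    Φ.deodharSum σ u = ∑ τ : Finset (Fin r) with
      Φ.IsDistinguished Φ.posRoots (-Φ.posRoots) σ Finset.univ τ ∧ Φ.subProd σ τ = u,
        heckeParam ^ kappa τ := by
  rw [deodharSum, Finsupp.finsetSum_apply, ← Finset.filter_filter,
    Finset.sum_filter (s := Finset.univ.filter _)]
  simp only [Finsupp.single_apply]

/-- Multiplication of the coefficients of a finitely supported function by units `v^{n(u)}`. -/
def twist (n : Φ.Weyl → ℤ) (c : Φ.Weyl →₀ ℤ[T;T⁻¹]) : Φ.Weyl →₀ ℤ[T;T⁻¹] :=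
  Finsupp.onFinset c.support (fun u => LaurentPolynomial.T (n u) * c u) fun u hu => by
    rw [Finsupp.mem_support_iff]
    exact right_ne_zero_of_mul hu

@[simp] theorem twist_apply (n : Φ.Weyl → ℤ) (c : Φ.Weyl →₀ ℤ[T;T⁻¹]) (u : Φ.Weyl) :
    Φ.twist n c u = LaurentPolynomial.T (n u) * c u := rfl

theorem linearCombination_twist (n : Φ.Weyl → ℤ) (c : Φ.Weyl →₀ ℤ[T;T⁻¹]) :
    Finsupp.linearCombination ℤ[T;T⁻¹] (fun u => Φ.bar (Φ.heckeT u)) (Φ.twist n c) =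
      c.sum fun u a => (LaurentPolynomial.T (n u) * a) • Φ.bar (Φ.heckeT u) := by
  rw [Finsupp.linearCombination_apply,
    Finsupp.sum_of_support_subset (Φ.twist n c) Finsupp.support_onFinset_subset _ (by simp)]
  rfl

/-- Linear independence lets the coefficients be compared for every reduced expression; conversely
one reduced expression for each `w` suffices. -/
theorem isRPolynomialFamily_iff {R : Φ.Weyl → Φ.Weyl →₀ ℤ[T;T⁻¹]} :
    Φ.IsRPolynomialFamily R ↔ ∀ (w : Φ.Weyl) (r : ℕ) (σ : Fin r → I), Φ.IsReduced σ →
      Φ.prod σ = w → ∀ u, R w u =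
        LaurentPolynomial.T ((Φ.length w : ℤ) - Φ.length u) * Φ.deodharSum σ u := by
  constructor
  · rintro h w r σ hσ rfl u
    have h1 := h (Φ.prod σ)
    rw [← linearCombination_twist, ← Φ.linearCombination_deodharSum σ hσ] at h1
    rw [Φ.linearIndependent_bar_heckeT h1, twist_apply, ← mul_assoc, T_sub_mul_T_sub, one_mul]
  · intro h w
    obtain ⟨σ, hσ⟩ := Φ.exists_reduced w
    have hr : Φ.IsReduced σ := by rw [IsReduced, hσ]
    rw [← linearCombination_twist]
    conv_lhs => rw [← hσ, ← Φ.linearCombination_deodharSum σ hr]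
    congr 1
    ext1 u
    rw [twist_apply, h w _ σ hr hσ, ← mul_assoc, T_sub_mul_T_sub, one_mul]

theorem existsUnique_isRPolynomialFamily :
    ∃! R : Φ.Weyl → Φ.Weyl →₀ ℤ[T;T⁻¹], Φ.IsRPolynomialFamily R := by
  have hred : ∀ w, Φ.IsReduced (Φ.exists_reduced w).choose := fun w => by
    rw [IsReduced, (Φ.exists_reduced w).choose_spec]
  refine ⟨fun w => Φ.twist (fun u => (Φ.length w : ℤ) - Φ.length u)
    (Φ.deodharSum (Φ.exists_reduced w).choose), ?_, ?_⟩
  · intro w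
    rw [← linearCombination_twist]
    conv_lhs => rw [← (Φ.exists_reduced w).choose_spec,
      ← Φ.linearCombination_deodharSum _ (hred w)]
    congr 1
    ext1 u
    rw [twist_apply, twist_apply, ← mul_assoc, T_sub_mul_T_sub, one_mul]
  · intro R hR
    funext w
    ext1 u
    exact Φ.isRPolynomialFamily_iff.mp hR w _ _ (hred w) (Φ.exists_reduced w).choose_spec u

end KacMoodyRootSystem
end
open Classical in
theorem mainTheorem4 {I V : Type*} [AddCommGroup V] [Module ℝ V] (Φ : KacMoodyRootSystem I V) :
    Φ.IsOrientation Φ.posRoots ∧ Φ.IsOrientation (-Φ.posRoots) ∧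
    (∃! R : Φ.Weyl → Φ.Weyl →₀ ℤ[T;T⁻¹], Φ.IsRPolynomialFamily R) ∧
    ∀ R : Φ.Weyl → Φ.Weyl →₀ ℤ[T;T⁻¹], Φ.IsRPolynomialFamily R →
      ∀ (u w : Φ.Weyl) (r : ℕ) (σ : Fin r → I), Φ.IsReduced σ → Φ.prod σ = w →
        R w u = ∑ τ : Finset (Fin r) with
            Φ.IsDistinguished Φ.posRoots (-Φ.posRoots) σ Finset.univ τ ∧ Φ.subProd σ τ = u,
          LaurentPolynomial.T ((Φ.length w : ℤ) - (Φ.length u : ℤ)) *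
            (LaurentPolynomial.T 1 - LaurentPolynomial.T (-1)) ^
              KacMoodyRootSystem.kappa τ := by
  refine ⟨Φ.isOrientation_posRoots, Φ.isOrientation_posRoots.neg,
    Φ.existsUnique_isRPolynomialFamily, fun R hR u w r σ hσ hw => ?_⟩
  rw [Φ.isRPolynomialFamily_iff.mp hR w r σ hσ hw u, Φ.deodharSum_apply, Finset.mul_sum]
  rfl
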